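/- Let $q$ be a prime power and $n\ge 1$ an integer with $\gcd(q,n)=1$. Let $D_n=\langle a,b \mid a^n=b^2=1,\ bab=a^{-1}\rangle$ be the dihedral group of order $2n$. A $D_n$-code over $\mathbb{F}_{q^2}$ is a left ideal $I$ of the group algebra $\mathbb{F}_{q^2}[D_n]$; it is called hermitian self-orthogonal if $\sum_{g\in D_n} u_g v_g^{\,q}=0$ for all $u=\sum_g u_g g$ and $v=\sum_g v_g g$ in $I$. For a polynomial $f=\sum_i a_i x^i\in\mathbb{F}_{q^2}[x]$ with $f(0)\ne 0$ write $f^*(x)=f(0)^{-1}x^{\deg f}f(x^{-1})$, $\overline f=\sum_i a_i^q x^i$ and $f^\dagger=\overline{f^*}$. Let $$x^n-1=\prod_{j\in J_0}f_j\ \prod_{j\in J_1}f_j\overline{f_j}\ \prod_{j\in J_2\cup J_3}f_jf_j^*\ \prod_{j\in J_4}f_jf_j^*\overline{f_j}f_j^\dagger$$ be a decomposition of $x^n-1$ into monic irreducible factors over $\mathbb{F}_{q^2}$, where $j\in J_0$ iff $f_j=\overline{f_j}=f_j^*$; $j\in J_1$ iff $f_j=f_j^*\neq\overline{f_j}$;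 $j\in J_2$ iff $f_j=\overline{f_j}\ne f_j^*$; $j\in J_3$ iff $\overline{f_j}=f_j^*\neq f_j$; and $j\in J_4$ iff $f_j,\overline{f_j},f_j^*$ are pairwise different. Put $r_j=\deg f_j$. Then the number of hermitian self-orthogonal $D_n$-codes over $\mathbb{F}_{q^2}$ is $$\prod_{j\in J_1}\left(3q^{r_j}+6\right)\prod_{j\in J_2\cup J_3}\left(q^{r_j}+2\right)\prod_{j\in J_4}\left(3q^{2r_j}+6\right)\quad\text{if } q \text{ is odd},$$ and $$2\prod_{j\in J_1}\left(3q^{r_j}+6\right)\prod_{j\in J_2\cup J_3}\left(q^{r_j}+2\right)\prod_{j\in J_4}\left(3q^{2r_j}+6\right)\quad\text{if } q \text{ is even}.$$ -/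

import Mathlib

namespace DihedralCodes

open Polynomial

section GroupAlgebra

variable {F G : Type*} [Field F] [Group G] [Fintype G]

/-- The hermitian inner product `(a|b)_H = ∑ g, a_g * b_g ^ q` on the group algebra `F[G]`,
to be used when `F` has `q ^ 2` elements. -/
def hermInner (q : ℕ) (a b : MonoidAlgebra F G) : F :=
  ∑ g : G, a.coeff g * b.coeff g ^ q

/-- The hermitian dual of a left ideal `I` of `F[G]`. (In Mathlib, an `Ideal` of a
noncommutative ring is a left ideal.) -/
def hermDual (q : ℕ) (I : Ideal (MonoidAlgebra F G)) : Set (MonoidAlgebra F G) :=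
  {b | ∀ a ∈ I, hermInner q a b = 0}

/-- A `G`-code (left ideal of `F[G]`) is hermitian self-orthogonal if it is contained in its
hermitian dual. -/
def IsHermSelfOrthogonal (q : ℕ) (I : Ideal (MonoidAlgebra F G)) : Prop :=
  (I : Set (MonoidAlgebra F G)) ⊆ hermDual q I

end GroupAlgebra

section Polynomials

variable {F : Type*} [Field F]

/-- The reciprocal polynomial `g*(x) = g(0)⁻¹ x ^ (deg g) g(x⁻¹)`. -/
noncomputable def recip (g : F[X]) : F[X] :=
  C (g.coeff 0)⁻¹ * g.reverse

/-- The conjugate polynomial, obtained by raising every coefficient to the `q`-th power. -/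
noncomputable def conj (q : ℕ) (g : F[X]) : F[X] :=
  ∑ i ∈ Finset.range (g.natDegree + 1), C (g.coeff i ^ q) * X ^ i

/-- The conjugate of the reciprocal polynomial. -/
noncomputable def dagger (q : ℕ) (g : F[X]) : F[X] :=
  conj q (recip g)

variable {ι : Type*} [Fintype ι]

open Classical in
/-- Indices with `f_j` both self-conjugate and self-reciprocal. -/
noncomputable def J0 (q : ℕ) (f : ι → F[X]) : Finset ι :=
  Finset.univ.filter fun j => f j = conj q (f j) ∧ f j = recip (f j)

open Classical in
/-- Indices with `f_j` self-reciprocal but not self-conjugate. -/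
noncomputable def J1 (q : ℕ) (f : ι → F[X]) : Finset ι :=
  Finset.univ.filter fun j => f j = recip (f j) ∧ f j ≠ conj q (f j)

open Classical in
/-- Indices with `f_j` self-conjugate but not self-reciprocal. -/
noncomputable def J2 (q : ℕ) (f : ι → F[X]) : Finset ι :=
  Finset.univ.filter fun j => f j = conj q (f j) ∧ f j ≠ recip (f j)

open Classical in
/-- Indices where the conjugate and the reciprocal of `f_j` agree and differ from `f_j`. -/
noncomputable def J3 (q : ℕ) (f : ι → F[X]) : Finset ι :=
  Finset.univ.filter fun j => conj q (f j) = recip (f j) ∧ f j ≠ recip (f j)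

open Classical in
/-- Indices where `f_j`, its conjugate and its reciprocal are pairwise different. -/
noncomputable def J4 (q : ℕ) (f : ι → F[X]) : Finset ι :=
  Finset.univ.filter fun j =>
    f j ≠ conj q (f j) ∧ f j ≠ recip (f j) ∧ conj q (f j) ≠ recip (f j)

open Classical in
/-- The family `f` gives the decomposition of `x ^ n - 1` into monic irreducible factors over
`F`, grouped together with their reciprocals and conjugates. -/
structure IsDecomposition (q n : ℕ) (f : ι → F[X]) : Prop where
  monic : ∀ j, (f j).Monic
  irreducible : ∀ j, Irreducible (f j)
  prod_eq : (X ^ n - 1 : F[X]) =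
    (∏ j ∈ J0 q f, f j) *
    (∏ j ∈ J1 q f, f j * conj q (f j)) *
    (∏ j ∈ J2 q f ∪ J3 q f, f j * recip (f j)) *
    (∏ j ∈ J4 q f, f j * recip (f j) * conj q (f j) * dagger q (f j))

open Classical in
/-- The product `∏_{J₁} (3 q^{r_j} + 6) ∏_{J₂ ∪ J₃} (q^{r_j} + 2) ∏_{J₄} (3 q^{2 r_j} + 6)`,
where `r_j` is the degree of `f_j`. -/
noncomputable def codeCount (q : ℕ) (f : ι → F[X]) : ℕ :=
  (∏ j ∈ J1 q f, (3 * q ^ (f j).natDegree + 6)) *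
  (∏ j ∈ J2 q f ∪ J3 q f, (q ^ (f j).natDegree + 2)) *
  (∏ j ∈ J4 q f, (3 * q ^ (2 * (f j).natDegree) + 6))

end Polynomials

end DihedralCodes

/-! The coefficient of `u * hermAdj τ v` at the identity is the hermitian product of `u` and `v`,
where `hermAdj τ` is the anti-automorphism sending `g` to its inverse and acting on scalars by the
Frobenius `τ : k ↦ k ^ q`. A left ideal absorbs translates by group elements, so self-orthogonality
of `I` means `u * hermAdj τ v = 0` for all `u, v ∈ I` (`isHermSelfOrthogonal_iff`). This condition
refers only to a ring with an adjoint: it passes through isomorphisms, and its count is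
multiplicative over products.

The group algebra splits, compatibly with the adjoint, into one piece per index `j`, cut out by the
factor `g_j` of `X ^ n - 1` that groups `f_j` with its conjugate and reciprocal. Write `θ` for a
root of `f_j`, `E = F(θ)` and `r = deg f_j`.

If `f_j` is its own conjugate, or its conjugate is its reciprocal, but it is not self-reciprocal,
the piece is `M₂(E)` with a unitary adjoint `M ↦ P * (c M)ᵀ * P`, where `c` is the involution of `E`
extending `τ`. Left ideals of `M₂(E)` are subspaces of the plane, and those sought are the isotropic
ones: zero and `q ^ r + 1` lines.

In the classes `J1` and `J4` the adjoint exchanges two copies of some `M₂(L)`, and one counts pairs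
of orthogonal subspaces of the plane: `3 * |L| + 6` of them. For `J4`, `L = E`; for `J1`, `L` is the
fixed field in `E` of `θ ↦ θ⁻¹`, of order `q ^ r`.

A finite field has at most one nontrivial involution, which forces `θ = θ⁻¹` in the class `J0`; its
factors are `X ∓ 1`. In odd characteristic their pieces `F × F` are anisotropic and contribute 1. In
characteristic two the single factor `X - 1` gives the dual numbers, with the two ideals `0` and
`(ε)`; hence the extra factor 2. -/

namespace DihedralCodes

open Polynomial

/-! ### Isotropic left ideals of a ring with an adjoint -/

section IsotropicIdeals

/-- The left ideals `I` of `R` with `u * s v = 0` for all `u, v ∈ I`. -/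
def isotropicIdeals {R : Type*} [Ring R] (s : R → R) : Set (Ideal R) :=
  {I | ∀ u ∈ I, ∀ v ∈ I, u * s v = 0}

theorem ncard_isotropicIdeals_congr {R S : Type*} [Ring R] [Ring S] {s : R → R} {t : S → S}
    (e : R ≃+* S) (h : ∀ x, e (s x) = t (e x)) :
    (isotropicIdeals s).ncard = (isotropicIdeals t).ncard := by
  have : isotropicIdeals s = (e.idealComapOrderIso) '' (isotropicIdeals t) := by
    ext I
    rw [OrderIso.image_eq_preimage_symm]
    simp only [isotropicIdeals, Set.mem_ofPred_eq, Set.mem_preimage]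
    constructor
    · intro hI u hu v hv
      have hu' : e.symm u ∈ I := by simpa [RingEquiv.idealComapOrderIso] using hu
      have hv' : e.symm v ∈ I := by simpa [RingEquiv.idealComapOrderIso] using hv
      have := congrArg e (hI _ hu' _ hv')
      simpa [h] using this
    · intro hI u hu v hv
      have := hI (e u) (by simpa [RingEquiv.idealComapOrderIso] using hu) (e v)
        (by simpa [RingEquiv.idealComapOrderIso] using hv)
      rw [← h, ← map_mul] at this
      exact (map_eq_zero_iff e e.injective).1 this
  rw [this, Set.ncard_image_of_injective _ (OrderIso.injective _)]

theorem ncard_isotropicIdeals_pi {ι : Type*} [Fintype ι] {B : ι → Type*} [∀ j, Ring (B j)]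
    (s : ∀ j, B j → B j) :
    (isotropicIdeals (fun (x : ∀ j, B j) j => s j (x j))).ncard =
      ∏ j, (isotropicIdeals (s j)).ncard := by
  classical
  have : isotropicIdeals (fun (x : ∀ j, B j) j => s j (x j)) =
      Ideal.piOrderIso.symm '' (Set.univ.pi fun j => isotropicIdeals (s j)) := by
    ext I
    rw [OrderIso.image_eq_preimage_symm]
    obtain ⟨J, rfl⟩ := Ideal.piOrderIso.symm.surjective I
    simp only [isotropicIdeals, Set.mem_ofPred_eq, Set.mem_preimage, OrderIso.symm_symm,
      OrderIso.apply_symm_apply, Set.mem_pi, Set.mem_univ, true_imp_iff]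
    simp only [Ideal.piOrderIso, OrderIso.symm_symm]
    constructor
    · intro h j u hu v hv
      have := congrFun (h (Pi.single j u) ?_ (Pi.single j v) ?_) j
      · simpa using this
      all_goals
        intro i
        by_cases hij : i = j
        · subst hij; simpa
        · simp [hij]
    · intro h u hu v hv
      ext j
      exact h j _ (hu j) _ (hv j)
  rw [this, Set.ncard_image_of_injective _ (OrderIso.injective _), ← Nat.card_coe_set_eq,
    Nat.card_congr (Equiv.Set.univPi _), Nat.card_pi]
  simp [Nat.card_coe_set_eq]

theorem isotropicIdeals_eq_singleton_bot {R : Type*} [Ring R] {s : R → R}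
    (h : ∀ u, u * s u = 0 → u = 0) : isotropicIdeals s = {⊥} := by
  ext I
  simp only [isotropicIdeals, Set.mem_ofPred_eq, Set.mem_singleton_iff]
  constructor
  · intro hI
    rw [eq_bot_iff]
    intro u hu
    exact h u (hI u hu u hu)
  · rintro rfl u hu v hv
    simp [(Submodule.mem_bot R).1 hu]

/-- A left ideal of `B × B` is a pair `J × K`. Isotropy gives one equation in each coordinate, and
`ht` says that `t` carries the first to the second, so only one survives. -/
theorem ncard_isotropicIdeals_prod {B : Type*} [Ring B] (t : B → B) (h0 : t 0 = 0)
    (ht : ∀ x y, t (x * t y) = y * t x) :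
    (isotropicIdeals (fun x : B × B => (t x.2, t x.1))).ncard =
      {p : Ideal B × Ideal B | ∀ u ∈ p.1, ∀ v ∈ p.2, u * t v = 0}.ncard := by
  have : isotropicIdeals (fun x : B × B => (t x.2, t x.1)) =
      Ideal.idealProdEquiv.symm ''
        {p : Ideal B × Ideal B | ∀ u ∈ p.1, ∀ v ∈ p.2, u * t v = 0} := by
    ext I
    rw [OrderIso.image_eq_preimage_symm]
    obtain ⟨⟨J, K⟩, rfl⟩ := Ideal.idealProdEquiv.symm.surjective I
    simp only [isotropicIdeals, Set.mem_ofPred_eq, Set.mem_preimage, OrderIso.symm_symm,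
      OrderIso.apply_symm_apply]
    simp only [Ideal.idealProdEquiv_symm_apply]
    constructor
    · intro h u hu v hv
      exact congrArg Prod.fst (h (u, 0) ⟨hu, K.zero_mem⟩ (0, v) ⟨J.zero_mem, hv⟩)
    · rintro h ⟨u, u'⟩ ⟨hu, hu'⟩ ⟨v, v'⟩ ⟨hv, hv'⟩
      refine Prod.ext (h u hu v' hv') ?_
      have := congrArg t (h v hv u' hu')
      rw [ht, h0] at this
      exact this
  rw [this, Set.ncard_image_of_injective _ (OrderIso.injective _)]

end IsotropicIdeals

/-! ### Left ideals of 2 × 2 matrices as subspaces of the plane -/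

section MatrixIdeals

variable {E : Type*} [Field E]

/-- The left ideal of matrices all of whose rows lie in `U`. -/
def rowIdeal (U : Submodule E (Fin 2 → E)) : Ideal (Matrix (Fin 2) (Fin 2) E) where
  carrier := {M | ∀ i, M i ∈ U}
  add_mem' := fun ha hb i => U.add_mem (ha i) (hb i)
  zero_mem' := fun _ => U.zero_mem
  smul_mem' := by
    intro c M hM i
    have : (c • M) i = ∑ k, c i k • M k := by
      ext j
      simp [Matrix.mul_apply]
    rw [this]
    exact U.sum_mem fun k _ => U.smul_mem _ (hM k)

theorem mem_rowIdeal {U : Submodule E (Fin 2 → E)} {M : Matrix (Fin 2) (Fin 2) E} :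
    M ∈ rowIdeal U ↔ ∀ i, M i ∈ U := Iff.rfl

/-- The space of rows of elements of a left ideal. -/
def rowSpace (I : Ideal (Matrix (Fin 2) (Fin 2) E)) : Submodule E (Fin 2 → E) where
  carrier := {v | Matrix.of ![v, 0] ∈ I}
  add_mem' := by
    intro a b ha hb
    have := I.add_mem ha hb
    rw [Set.mem_ofPred_eq]
    convert this using 1
    ext i j
    fin_cases i <;> simp
  zero_mem' := by
    have : (Matrix.of ![0, 0] : Matrix (Fin 2) (Fin 2) E) = 0 := by
      ext i j
      fin_cases i <;> simp
    simp only [Set.mem_ofPred_eq, this, I.zero_mem]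
  smul_mem' := by
    intro c v hv
    have := I.mul_mem_left (Matrix.diagonal fun _ => c) hv
    rw [Set.mem_ofPred_eq]
    convert this using 1
    ext i j
    fin_cases i <;> simp

theorem mem_rowSpace {I : Ideal (Matrix (Fin 2) (Fin 2) E)} {v : Fin 2 → E} :
    v ∈ rowSpace I ↔ Matrix.of ![v, 0] ∈ I := Iff.rfl

/-- Left ideals of `2 × 2` matrices correspond to subspaces of the space of row vectors. -/
def rowIdealEquiv : Submodule E (Fin 2 → E) ≃ Ideal (Matrix (Fin 2) (Fin 2) E) where
  toFun := rowIdeal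
  invFun := rowSpace
  left_inv := by
    intro U
    ext v
    rw [mem_rowSpace, mem_rowIdeal]
    constructor
    · intro h; exact h 0
    · intro h i; fin_cases i
      · exact h
      · exact U.zero_mem
  right_inv := by
    intro I
    ext M
    rw [mem_rowIdeal]
    simp only [mem_rowSpace]
    constructor
    · intro h
      have h0 := h 0
      have h1 := I.mul_mem_left (!![0, 0; 1, 0]) (h 1)
      convert I.add_mem h0 h1 using 1
      ext i j
      fin_cases i <;> simp
    · intro h i
      have := I.mul_mem_left (Matrix.of ![Pi.single i 1, 0]) h
      convert this using 1
      ext a b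
      fin_cases a <;> simp [Matrix.mul_apply, Pi.single_apply]

/-- A left ideal consists of all matrices with rows in a fixed subspace, so a condition on pairs of
matrices that can be tested on pairs of rows becomes a condition on that subspace. -/
theorem ncard_isotropicIdeals_matrix (s : Matrix (Fin 2) (Fin 2) E → Matrix (Fin 2) (Fin 2) E)
    (b : (Fin 2 → E) → (Fin 2 → E) → E)
    (h : ∀ M N, M * s N = 0 ↔ ∀ i j, b (M i) (N j) = 0) :
    (isotropicIdeals s).ncard =
      {U : Submodule E (Fin 2 → E) | ∀ u ∈ U, ∀ v ∈ U, b u v = 0}.ncard := by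
  have : isotropicIdeals s =
      rowIdealEquiv '' {U : Submodule E (Fin 2 → E) | ∀ u ∈ U, ∀ v ∈ U, b u v = 0} := by
    ext I
    rw [Equiv.image_eq_preimage_symm]
    obtain ⟨U, rfl⟩ := rowIdealEquiv.surjective I
    simp only [isotropicIdeals, Set.mem_ofPred_eq, Set.mem_preimage, Equiv.symm_apply_apply]
    simp only [rowIdealEquiv, Equiv.coe_fn_mk, mem_rowIdeal, h]
    constructor
    · intro H u hu v hv
      exact H (fun _ => u) (fun _ => hu) (fun _ => v) (fun _ => hv) 0 0
    · intro H M hM N hN i j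
      exact H _ (hM i) _ (hN j)
  rw [this, Set.ncard_image_of_injective _ (Equiv.injective _)]

theorem ncard_idealPairs_matrix :
    {p : Ideal (Matrix (Fin 2) (Fin 2) E) × Ideal (Matrix (Fin 2) (Fin 2) E) |
        ∀ u ∈ p.1, ∀ v ∈ p.2, u * v.transpose = 0}.ncard =
      {p : Submodule E (Fin 2 → E) × Submodule E (Fin 2 → E) |
        ∀ u ∈ p.1, ∀ v ∈ p.2, u ⬝ᵥ v = 0}.ncard := by
  have : {p : Ideal (Matrix (Fin 2) (Fin 2) E) × Ideal (Matrix (Fin 2) (Fin 2) E) |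
        ∀ u ∈ p.1, ∀ v ∈ p.2, u * v.transpose = 0} =
      (rowIdealEquiv.prodCongr rowIdealEquiv) ''
        {p : Submodule E (Fin 2 → E) × Submodule E (Fin 2 → E) |
          ∀ u ∈ p.1, ∀ v ∈ p.2, u ⬝ᵥ v = 0} := by
    ext I
    rw [Equiv.image_eq_preimage_symm]
    obtain ⟨⟨U, V⟩, rfl⟩ := (rowIdealEquiv.prodCongr rowIdealEquiv).surjective I
    simp only [Set.mem_ofPred_eq, Set.mem_preimage, Equiv.symm_apply_apply]
    simp only [rowIdealEquiv, Equiv.prodCongr_apply, Prod.map, Equiv.coe_fn_mk, mem_rowIdeal]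
    have key : ∀ M N : Matrix (Fin 2) (Fin 2) E,
        M * N.transpose = 0 ↔ ∀ i j, M i ⬝ᵥ N j = 0 := by
      intro M N
      rw [← Matrix.ext_iff]
      rfl
    simp only [key]
    constructor
    · intro H u hu v hv
      exact H (fun _ => u) (fun _ => hu) (fun _ => v) (fun _ => hv) 0 0
    · intro H M hM N hN i j
      exact H _ (hM i) _ (hN j)
  rw [this, Set.ncard_image_of_injective _ (Equiv.injective _)]

end MatrixIdeals

/-! ### Isotropic subspaces and orthogonal pairs in the plane -/

section Plane

variable {E : Type*} [Field E]

/-- The normalized generator of a line in the plane. -/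
def lineGen (p : Option E) : Fin 2 → E := p.elim ![0, 1] fun t => ![1, t]

@[simp] theorem lineGen_none : lineGen (none : Option E) = ![0, 1] := rfl
@[simp] theorem lineGen_some (t : E) : lineGen (some t) = ![1, t] := rfl

theorem lineGen_ne_zero (p : Option E) : lineGen p ≠ 0 := by
  intro h
  cases p with
  | none => simpa using congrFun h 1
  | some t => simpa using congrFun h 0

theorem eq_of_smul_lineGen {p p' : Option E} {c : E} (h : lineGen p' = c • lineGen p) :
    p' = p := by
  have h0 := congrFun h 0
  have h1 := congrFun h 1
  cases p with
  | none => cases p' with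
    | none => rfl
    | some t' =>
      simp only [lineGen_some, lineGen_none, Pi.smul_apply, Matrix.cons_val_zero,
        smul_zero] at h0
      exact (one_ne_zero h0).elim
  | some t => cases p' with
    | none =>
      have hc : c = 0 := by simpa using h0.symm
      simp [hc] at h1
    | some t' =>
      have hc : c = 1 := by simpa using h0.symm
      simpa [hc] using h1

theorem exists_smul_lineGen (v : Fin 2 → E) : ∃ p, ∃ c : E, v = c • lineGen p := by
  by_cases h : v 0 = 0
  · refine ⟨none, v 1, ?_⟩
    ext i; fin_cases i <;> simp [h]
  · refine ⟨some (v 1 / v 0), v 0, ?_⟩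
    ext i; fin_cases i
    · simp
    · simp [mul_div_cancel₀ _ h]

/-- The subspaces of the plane: the zero space, the plane itself and the lines. -/
def planeSubspace : Bool ⊕ Option E → Submodule E (Fin 2 → E)
  | Sum.inl false => ⊥
  | Sum.inl true => ⊤
  | Sum.inr p => Submodule.span E {lineGen p}

theorem mem_line {p : Option E} {v : Fin 2 → E} :
    v ∈ planeSubspace (Sum.inr p) ↔ ∃ c : E, v = c • lineGen p := by
  simp only [planeSubspace, Submodule.mem_span_singleton]
  exact ⟨fun ⟨c, h⟩ => ⟨c, h.symm⟩, fun ⟨c, h⟩ => ⟨c, h.symm⟩⟩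

theorem lineGen_mem_line (p : Option E) : lineGen p ∈ planeSubspace (Sum.inr p) :=
  mem_line.2 ⟨1, by simp⟩

theorem planeSubspace_surjective :
    Function.Surjective (planeSubspace : Bool ⊕ Option E → Submodule E (Fin 2 → E)) := by
  intro U
  by_cases h0 : U = ⊥
  · exact ⟨Sum.inl false, h0.symm⟩
  obtain ⟨v, hv, hv0⟩ := (Submodule.ne_bot_iff _).1 h0
  obtain ⟨p, c, rfl⟩ := exists_smul_lineGen v
  have hc : c ≠ 0 := by rintro rfl; simp at hv0
  have hp : lineGen p ∈ U := by
    have := U.smul_mem c⁻¹ hv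
    rwa [smul_smul, inv_mul_cancel₀ hc, one_smul] at this
  by_cases h1 : U ≤ planeSubspace (Sum.inr p)
  · refine ⟨Sum.inr p, le_antisymm ?_ h1⟩
    simpa [planeSubspace] using hp
  · refine ⟨Sum.inl true, ?_⟩
    obtain ⟨w, hw, hwp⟩ := Set.not_subset.1 h1
    obtain ⟨p', c', rfl⟩ := exists_smul_lineGen w
    have hc' : c' ≠ 0 := by rintro rfl; exact hwp (by simp)
    have hp' : lineGen p' ∈ U := by
      have := U.smul_mem c'⁻¹ hw
      rwa [smul_smul, inv_mul_cancel₀ hc', one_smul] at this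
    have hne : p' ≠ p := by rintro rfl; exact hwp (mem_line.2 ⟨c', rfl⟩)
    have hdet : lineGen p 0 * lineGen p' 1 - lineGen p 1 * lineGen p' 0 ≠ 0 := by
      cases p <;> cases p' <;> simp_all [sub_eq_zero]
    symm
    simp only [planeSubspace]
    rw [eq_top_iff]
    intro x _
    set d := lineGen p 0 * lineGen p' 1 - lineGen p 1 * lineGen p' 0 with hd
    -- Cramer's rule: the two generators have nonzero determinant `d`, hence span the plane.
    have : x = ((x 0 * lineGen p' 1 - x 1 * lineGen p' 0) / d) • lineGen p +
        ((lineGen p 0 * x 1 - lineGen p 1 * x 0) / d) • lineGen p' := by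
      ext i
      fin_cases i
      · simp only [Fin.zero_eta, Pi.add_apply, Pi.smul_apply, smul_eq_mul]
        field_simp
        rw [hd]; ring
      · simp only [Fin.mk_one, Pi.add_apply, Pi.smul_apply, smul_eq_mul]
        field_simp
        rw [hd]; ring
    rw [this]
    exact U.add_mem (U.smul_mem _ hp) (U.smul_mem _ hp')

theorem planeSubspace_injective :
    Function.Injective (planeSubspace : Bool ⊕ Option E → Submodule E (Fin 2 → E)) := by
  have hbot : ∀ p : Option E, planeSubspace (Sum.inr p) ≠ ⊥ := by
    intro p h
    have := lineGen_mem_line p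
    rw [h, Submodule.mem_bot] at this
    exact lineGen_ne_zero p this
  have hline : ∀ p p' : Option E, lineGen p' ∈ planeSubspace (Sum.inr p) → p' = p := by
    intro p p' h
    obtain ⟨c, hc⟩ := mem_line.1 h
    exact eq_of_smul_lineGen hc
  have htop : ∀ p : Option E, planeSubspace (Sum.inr p) ≠ ⊤ := by
    intro p h
    have h1 := hline p none (h ▸ Submodule.mem_top)
    have h2 := hline p (some 0) (h ▸ Submodule.mem_top)
    rw [← h2] at h1
    simp at h1
  have hbt : (⊥ : Submodule E (Fin 2 → E)) ≠ ⊤ := bot_ne_top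
  rintro ((_ | _) | p) ((_ | _) | p') h
  · rfl
  · exact (hbt h).elim
  · exact (hbot p' h.symm).elim
  · exact (hbt h.symm).elim
  · rfl
  · exact (htop p' h.symm).elim
  · exact (hbot p h).elim
  · exact (htop p h).elim
  · rw [hline p' p (h ▸ lineGen_mem_line p)]

/-- The number of isotropic subspaces of the plane for a sesquilinear form. -/
theorem ncard_isotropicSubspaces [Finite E] (τ : E → E) (b : (Fin 2 → E) → (Fin 2 → E) → E)
    (hb : ∀ c d u v, b (c • u) (d • v) = c * τ d * b u v) (hb0 : ∃ u v, b u v ≠ 0) :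
    {U : Submodule E (Fin 2 → E) | ∀ u ∈ U, ∀ v ∈ U, b u v = 0}.ncard =
      {p : Option E | b (lineGen p) (lineGen p) = 0}.ncard + 1 := by
  -- A line is isotropic exactly when its generator is, by `hb`; the plane is excluded because the
  -- form is not zero.
  have hrange : {U : Submodule E (Fin 2 → E) | ∀ u ∈ U, ∀ v ∈ U, b u v = 0} =
      planeSubspace '' (insert (Sum.inl false)
        (Sum.inr '' {p : Option E | b (lineGen p) (lineGen p) = 0})) := by
    ext U
    obtain ⟨x, rfl⟩ := planeSubspace_surjective U
    rw [planeSubspace_injective.mem_set_image, Set.mem_ofPred_eq]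
    rcases x with (_ | _) | p
    · simp only [Set.mem_insert_iff, true_or, iff_true]
      intro u hu v hv
      rw [(Submodule.mem_bot E).1 hu, (Submodule.mem_bot E).1 hv]
      simpa using hb 0 0 0 0
    · obtain ⟨u, v, huv⟩ := hb0
      simp only [planeSubspace, Set.mem_insert_iff, Sum.inl.injEq, Bool.true_eq_false,
        Set.mem_image, reduceCtorEq, and_false, exists_false, or_false, iff_false]
      exact fun h => huv (h u Submodule.mem_top v Submodule.mem_top)
    · simp only [Set.mem_insert_iff, reduceCtorEq, Set.mem_image, Set.mem_ofPred_eq,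
        Sum.inr.injEq, exists_eq_right, false_or]
      constructor
      · intro h
        exact h _ (lineGen_mem_line p) _ (lineGen_mem_line p)
      · intro h u hu v hv
        obtain ⟨c, rfl⟩ := mem_line.1 hu
        obtain ⟨d, rfl⟩ := mem_line.1 hv
        rw [hb, h, mul_zero]
  rw [hrange, Set.ncard_image_of_injective _ planeSubspace_injective,
    Set.ncard_insert_of_notMem (by simp) (Set.toFinite _),
    Set.ncard_image_of_injective _ Sum.inr_injective]

open Classical in
/-- The line orthogonal to a given line of the plane for the standard dot product. -/
noncomputable def perpLine : Option E → Option E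
  | none => some 0
  | some t => if t = 0 then none else some (-t⁻¹)

theorem lineGen_dotProduct_eq_zero (p p' : Option E) :
    lineGen p ⬝ᵥ lineGen p' = 0 ↔ p' = perpLine p := by
  cases p with
  | none => cases p' <;> simp [perpLine]
  | some t =>
    by_cases ht : t = 0
    · cases p' <;> simp [perpLine, ht]
    · cases p' with
      | none => simp [perpLine, ht]
      | some s =>
        simp only [lineGen_some, perpLine, if_neg ht, Option.some.injEq]
        have e : ![1, t] ⬝ᵥ ![1, s] = t * (s + t⁻¹) := by
          simp [mul_add, mul_inv_cancel₀ ht, add_comm]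
        rw [e, eq_neg_iff_add_eq_zero, mul_eq_zero, or_iff_right ht]

/-- With `Q = |E|` there are `Q + 1` lines. The zero space pairs with all `Q + 3` subspaces, the
plane only with zero, and each line with zero and its perpendicular line: `(Q + 3) + 1 + 2 * (Q + 1)
= 3 * Q + 6`. -/
theorem ncard_orthogonalPairs [Finite E] :
    {p : Submodule E (Fin 2 → E) × Submodule E (Fin 2 → E) |
      ∀ u ∈ p.1, ∀ v ∈ p.2, u ⬝ᵥ v = 0}.ncard = 3 * Nat.card E + 6 := by
  classical
  have := Fintype.ofFinite E
  set R : Bool ⊕ Option E → Finset (Bool ⊕ Option E) := fun x =>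
    match x with
    | Sum.inl false => Finset.univ
    | Sum.inl true => {Sum.inl false}
    | Sum.inr p => {Sum.inl false, Sum.inr (perpLine p)} with hR
  set g : (Σ _ : Bool ⊕ Option E, Bool ⊕ Option E) →
      Submodule E (Fin 2 → E) × Submodule E (Fin 2 → E) :=
    fun x => (planeSubspace x.1, planeSubspace x.2) with hg
  have hinj : Function.Injective g := by
    rintro ⟨x, y⟩ ⟨x', y'⟩ h
    simp only [hg, Prod.mk.injEq] at h
    rw [planeSubspace_injective h.1, planeSubspace_injective h.2]
  have key : {p : Submodule E (Fin 2 → E) × Submodule E (Fin 2 → E) |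
      ∀ u ∈ p.1, ∀ v ∈ p.2, u ⬝ᵥ v = 0} =
      g '' (Finset.univ.sigma R : Finset (Σ _ : Bool ⊕ Option E, Bool ⊕ Option E)) := by
    ext ⟨U, V⟩
    obtain ⟨x, rfl⟩ := planeSubspace_surjective U
    obtain ⟨y, rfl⟩ := planeSubspace_surjective V
    have e : (planeSubspace x, planeSubspace y) = g ⟨x, y⟩ := rfl
    rw [e, hinj.mem_set_image]
    simp only [hg, Set.mem_ofPred_eq, Finset.coe_sigma, Set.mem_sigma_iff,
      Finset.mem_coe, Finset.mem_univ, true_and]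
    rcases x with (_ | _) | p
    · simp only [hR, Finset.mem_univ, iff_true]
      intro u hu v hv
      rw [(Submodule.mem_bot E).1 hu, zero_dotProduct]
    · simp only [hR, Finset.mem_singleton]
      constructor
      · intro h
        apply planeSubspace_injective
        simp only [planeSubspace]
        rw [eq_bot_iff]
        intro v hv
        rw [Submodule.mem_bot]
        ext i
        simpa using h (Pi.single i 1) Submodule.mem_top v hv
      · rintro rfl u hu v hv
        rw [(Submodule.mem_bot E).1 hv, dotProduct_zero]
    · simp only [hR, Finset.mem_insert, Finset.mem_singleton]
      constructor
      · intro h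
        rcases y with (_ | _) | p'
        · simp
        · exfalso
          apply lineGen_ne_zero p
          ext i
          simpa using h _ (lineGen_mem_line p) (Pi.single i 1) Submodule.mem_top
        · right
          rw [(lineGen_dotProduct_eq_zero p p').1
            (h _ (lineGen_mem_line p) _ (lineGen_mem_line p'))]
      · rintro (rfl | rfl) u hu v hv
        · rw [(Submodule.mem_bot E).1 hv, dotProduct_zero]
        · obtain ⟨c, rfl⟩ := mem_line.1 hu
          obtain ⟨d, rfl⟩ := mem_line.1 hv
          rw [smul_dotProduct, dotProduct_smul, (lineGen_dotProduct_eq_zero _ _).2 rfl]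
          simp
  rw [key, Set.ncard_image_of_injective _ hinj, Set.ncard_coe_finset, Finset.card_sigma,
    Fintype.sum_sum_type, Fintype.sum_bool]
  have h2 : ∀ p : Option E, (R (Sum.inr p)).card = 2 := by
    intro p
    simp [hR]
  simp only [h2, Finset.sum_const, Finset.card_univ]
  simp [hR, Nat.card_eq_fintype_card]
  ring

end Plane

/-! ### Involutions, trace and norm equations over finite fields -/

section FiniteFields

/-- `X ^ |E| - X` splits with simple roots over `E`, and every divisor inherits this. -/
theorem ncard_roots_of_dvd {E : Type*} [Field E] [Fintype E] {P : E[X]}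
    (h : P ∣ X ^ Fintype.card E - X) : {x | P.eval x = 0}.ncard = P.natDegree := by
  classical
  have hq : 1 < Fintype.card E := Fintype.one_lt_card
  have hne : (X ^ Fintype.card E - X : E[X]) ≠ 0 := FiniteField.X_pow_card_sub_X_ne_zero E hq
  have hP : P ≠ 0 := fun h0 => hne (by simpa [h0] using h)
  have hr := FiniteField.roots_X_pow_card_sub_X E
  have hs : (X ^ Fintype.card E - X : E[X]).Splits := by
    rw [splits_iff_card_roots, hr, FiniteField.X_pow_card_sub_X_natDegree_eq E hq]
    simp
  have hPs : P.Splits := hs.of_dvd hne h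
  have hnd : P.roots.Nodup :=
    Multiset.nodup_of_le (roots.le_of_dvd hne h) (by rw [hr]; exact Finset.univ.nodup)
  have : {x | P.eval x = 0} = (P.roots.toFinset : Set E) := by
    ext x
    simp [hP]
  rw [this, Set.ncard_coe_finset, Multiset.toFinset_card_of_nodup hnd,
    splits_iff_card_roots.1 hPs]

/-- The only nontrivial involution of a field with `Q ^ 2` elements is `x ↦ x ^ Q`. -/
theorem involution_eq_pow {E : Type*} [Field E] [Finite E] {Q : ℕ} (hQ : Nat.card E = Q ^ 2)
    (c : E →+* E) (hc : ∀ x, c (c x) = x) (hne : ∃ x, c x ≠ x) (x : E) : c x = x ^ Q := by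
  have := Fintype.ofFinite E
  let e : RingAut E := RingEquiv.ofRingHom c c (RingHom.ext hc) (RingHom.ext hc)
  have he : ∀ x, e x = c x := fun _ => rfl
  let G := Subgroup.zpowers e
  have hord : orderOf e = 2 := by
    apply orderOf_eq_prime
    · ext x
      simp [pow_two, he, hc]
    · obtain ⟨x, hx⟩ := hne
      intro h
      apply hx
      rw [← he, h]; rfl
  have : Finite G := by
    apply Nat.finite_of_card_ne_zero
    rw [Nat.card_zpowers, hord]; norm_num
  have := Fintype.ofFinite G
  -- By Artin's theorem `E` has degree 2 over the fixed field `L`, so `|L| = Q`. Automorphisms of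
  -- `E` over `L` are powers of the `Q`-Frobenius with exponent 0 or 1, and exponent 0 is the
  -- identity.
  let L := FixedPoints.subfield G E
  have hfin : Module.finrank L E = 2 := by
    rw [FixedPoints.finrank_eq_card, ← Nat.card_eq_fintype_card, Nat.card_zpowers, hord]
  have hL : Nat.card L = Q := by
    have := Module.natCard_eq_pow_finrank (K := L) (V := E)
    rw [hfin, hQ] at this
    exact (Nat.pow_left_injective (n := 2) (by norm_num) this).symm
  let cA : E ≃ₐ[L] E := AlgEquiv.ofRingEquiv (f := e) (fun l => l.2 ⟨e, Subgroup.mem_zpowers e⟩)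
  have := Fintype.ofFinite L
  obtain ⟨⟨k, hk⟩, hk'⟩ :=
    (FiniteField.bijective_frobeniusAlgEquivOfAlgebraic_pow L E).2 cA
  have hx' := DFunLike.congr_fun hk'
  rw [hfin] at hk
  interval_cases k
  · obtain ⟨x, hx⟩ := hne
    exact (hx (by rw [← he]; exact (hx' x).symm)).elim
  · have := (hx' x).symm
    simp only [pow_one] at this
    rw [← he, ← hL, Nat.card_eq_fintype_card]
    exact this

variable {E : Type*} [Field E] [Finite E] {Q p k : ℕ}

theorem ncard_trace_isotropic (hQ : Nat.card E = Q ^ 2) [ExpChar E p] (hp : Q = p ^ k) :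
    {t : E | t + t ^ Q = 0}.ncard = Q := by
  have := Fintype.ofFinite E
  have hcard : Fintype.card E = Q * Q := by rw [← Nat.card_eq_fintype_card, hQ, sq]
  have hQ1 : 1 < Q := by
    have : 1 < Fintype.card E := Fintype.one_lt_card
    by_contra h
    interval_cases Q <;> omega
  have hdvd : (X ^ Q + X : E[X]) ∣ X ^ Fintype.card E - X := by
    -- As `Q` is a power of the characteristic exponent, `(X ^ Q + X) ^ Q = X ^ (Q ^ 2) + X ^ Q`.
    have : (X ^ Fintype.card E - X : E[X]) = (X ^ Q + X) ^ Q - (X ^ Q + X) := by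
      have h : ((X : E[X]) ^ Q + X) ^ Q = (X ^ Q) ^ Q + X ^ Q := by
        conv_lhs => rw [hp]
        rw [← hp, hp, add_pow_expChar_pow]
      rw [h, hcard, pow_mul]
      ring
    rw [this]
    exact dvd_sub (dvd_pow_self _ (by omega)) dvd_rfl
  have hdeg : (X ^ Q + X : E[X]).natDegree = Q := by
    compute_degree
    · simp [hQ1.ne]
    · omega
  refine Eq.trans ?_ ((ncard_roots_of_dvd hdvd).trans hdeg)
  congr 1
  ext t
  simp [add_comm]

theorem ncard_norm_isotropic (hQ : Nat.card E = Q ^ 2) [ExpChar E p] (hp : Q = p ^ k) :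
    {t : E | 1 + t * t ^ Q = 0}.ncard = Q + 1 := by
  have := Fintype.ofFinite E
  have hcard : Fintype.card E = Q * Q := by rw [← Nat.card_eq_fintype_card, hQ, sq]
  have hQ1 : 1 < Q := by
    have : 1 < Fintype.card E := Fintype.one_lt_card
    by_contra h
    interval_cases Q <;> omega
  have hdvd : (X ^ (Q + 1) + 1 : E[X]) ∣ X ^ Fintype.card E - X := by
    have h1 : (X ^ (Q + 1) + 1 : E[X]) ∣ (X ^ (Q + 1)) ^ Q + 1 := by
      have h : ((X : E[X]) ^ (Q + 1) + 1) ^ Q = (X ^ (Q + 1)) ^ Q + 1 := by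
        rw [hp, add_pow_expChar_pow, one_pow]
      rw [← h]
      exact dvd_pow_self _ (by omega)
    -- Modulo the factor `X ^ Q`, which is coprime to `X ^ (Q + 1) + 1`, the difference of `(X ^ (Q
    -- + 1) + 1) ^ Q` and `X ^ (Q + 1) + 1` is the field polynomial.
    have h2 : ((X : E[X]) ^ (Q + 1)) ^ Q + 1 - (X ^ (Q + 1) + 1) =
        X ^ Q * (X ^ Fintype.card E - X) := by
      rw [hcard]; ring
    have h3 : (X ^ (Q + 1) + 1 : E[X]) ∣ X ^ Q * (X ^ Fintype.card E - X) := by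
      rw [← h2]
      exact dvd_sub h1 dvd_rfl
    refine IsCoprime.dvd_of_dvd_mul_left ?_ h3
    refine IsCoprime.pow_right ⟨1, -X ^ Q, ?_⟩
    ring
  have hdeg : (X ^ (Q + 1) + 1 : E[X]).natDegree = Q + 1 := by
    compute_degree!
  refine Eq.trans ?_ ((ncard_roots_of_dvd hdvd).trans hdeg)
  congr 1
  ext t
  simp [add_comm, pow_succ, mul_comm]

end FiniteFields

/-! ### Homomorphisms out of the dihedral group -/

section DihedralHom

variable {n : ℕ} [NeZero n] {B : Type*} [Monoid B]

/-- The homomorphism from the dihedral group determined by the images of the generators. -/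
def dihedralHom (α β : B) (hα : α ^ n = 1) (hβ : β * β = 1) (h : α * β * α = β) :
    DihedralGroup n →* B where
  toFun
    | .r i => α ^ i.val
    | .sr i => β * α ^ i.val
  map_one' := by
    rw [DihedralGroup.one_def]
    simp
  map_mul' := by
    have hadd : ∀ i j : ZMod n, α ^ (i + j).val = α ^ i.val * α ^ j.val := by
      intro i j
      rw [← pow_add, ZMod.val_add, ← pow_eq_pow_mod _ hα]
    have hconj : ∀ k : ℕ, α ^ k * β * α ^ k = β := by
      intro k
      induction k with
      | zero => simp
      | succ k ih =>
        have : α ^ (k + 1) * β * α ^ (k + 1) = α ^ k * (α * β * α) * α ^ k := by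
          nth_rewrite 1 [pow_succ]
          rw [pow_succ']
          simp only [mul_assoc]
        rw [this, h, ih]
    have hsub : ∀ i j : ZMod n, α ^ i.val * β * α ^ j.val = β * α ^ (j - i).val := by
      intro i j
      have : j = i + (j - i) := by ring
      conv_lhs => rw [this, hadd, ← mul_assoc, hconj]
    rintro (i | i) (j | j)
    · exact hadd i j
    · rw [DihedralGroup.r_mul_sr]
      simp only [← hsub, mul_assoc]
    · rw [DihedralGroup.sr_mul_r]
      simp only [hadd, mul_assoc]
    · rw [DihedralGroup.sr_mul_sr]
      change α ^ (j - i).val = β * α ^ i.val * (β * α ^ j.val)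
      rw [mul_assoc, ← mul_assoc (α ^ i.val), hsub, ← mul_assoc, hβ, one_mul]

variable {α β : B} {hα : α ^ n = 1} {hβ : β * β = 1} {h : α * β * α = β}

@[simp] theorem dihedralHom_r (i : ZMod n) :
    dihedralHom α β hα hβ h (.r i) = α ^ i.val := rfl

@[simp] theorem dihedralHom_sr (i : ZMod n) :
    dihedralHom α β hα hβ h (.sr i) = β * α ^ i.val := rfl

end DihedralHom

/-! ### The hermitian adjoint on the group algebra -/

section HermAdj

variable {F G : Type*} [Field F] [Group G]

/-- The adjoint `∑ a_g g ↦ ∑ τ(a_g) g⁻¹` as a homomorphism to the opposite ring. -/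
noncomputable def hermAdjOp (τ : F →+* F) : MonoidAlgebra F G →+* (MonoidAlgebra F G)ᵐᵒᵖ :=
  MonoidAlgebra.liftNCRingHom
    (((MonoidAlgebra.singleOneRingHom : F →+* MonoidAlgebra F G).comp τ).toOpposite
      (fun _ _ => by simp [commute_iff_eq, MonoidAlgebra.single_mul_single, mul_comm]))
    { toFun := fun g => MulOpposite.op (MonoidAlgebra.single g⁻¹ 1)
      map_one' := by simp [MonoidAlgebra.one_def]
      map_mul' := fun _ _ => by
        rw [← MulOpposite.op_mul, MonoidAlgebra.single_mul_single, mul_inv_rev, one_mul] }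
    (fun _ _ => by
      simp [commute_iff_eq, ← MulOpposite.op_mul, MonoidAlgebra.single_mul_single])

/-- The adjoint `∑ a_g g ↦ ∑ τ(a_g) g⁻¹`. -/
noncomputable def hermAdj (τ : F →+* F) (x : MonoidAlgebra F G) : MonoidAlgebra F G :=
  (hermAdjOp τ x).unop

variable (τ : F →+* F)

@[simp] theorem hermAdj_single (g : G) (k : F) :
    hermAdj τ (MonoidAlgebra.single g k) = MonoidAlgebra.single g⁻¹ (τ k) := by
  simp [hermAdj, hermAdjOp, MonoidAlgebra.single_mul_single]

theorem hermAdj_add (x y : MonoidAlgebra F G) : hermAdj τ (x + y) = hermAdj τ x + hermAdj τ y := by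
  simp [hermAdj]

theorem hermAdj_mul (x y : MonoidAlgebra F G) : hermAdj τ (x * y) = hermAdj τ y * hermAdj τ x := by
  simp [hermAdj]

@[simp] theorem hermAdj_zero : hermAdj τ (0 : MonoidAlgebra F G) = 0 := by simp [hermAdj]

theorem hermAdj_hermAdj (hτ : ∀ k, τ (τ k) = k) (x : MonoidAlgebra F G) :
    hermAdj τ (hermAdj τ x) = x := by
  induction x using MonoidAlgebra.induction_linear with
  | zero => simp
  | add x y hx hy => rw [hermAdj_add, hermAdj_add, hx, hy]
  | single g k => simp [hτ]

variable [Fintype G] {τ} {q : ℕ}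

theorem hermInner_eq (hτ : ∀ k, τ k = k ^ q) (hq : q ≠ 0) (x y : MonoidAlgebra F G) :
    hermInner q x y = (x * hermAdj τ y).coeff 1 := by
  classical
  -- The form is additive in its second argument because the `q`-th power map is the ring
  -- homomorphism `τ`.
  have hpow : ∀ k l : F, (k + l) ^ q = k ^ q + l ^ q := fun k l => by
    rw [← hτ, ← hτ, ← hτ, map_add]
  induction x using MonoidAlgebra.induction_linear with
  | zero => simp [hermInner]
  | add x x' hx hx' =>
    rw [add_mul, MonoidAlgebra.coeff_add, Finsupp.add_apply, ← hx, ← hx']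
    simp [hermInner, add_mul, Finset.sum_add_distrib]
  | single g k =>
    induction y using MonoidAlgebra.induction_linear with
    | zero => simp [hermInner, hq]
    | add y y' hy hy' =>
      rw [hermAdj_add, mul_add, MonoidAlgebra.coeff_add, Finsupp.add_apply, ← hy, ← hy']
      simp [hermInner, mul_add, Finset.sum_add_distrib, hpow]
    | single h l =>
      rw [hermAdj_single, MonoidAlgebra.single_mul_single, hτ]
      simp only [hermInner, MonoidAlgebra.coeff_single, Finsupp.single_apply, mul_inv_eq_one]
      simp only [ite_mul, zero_mul, Finset.sum_ite_eq, Finset.mem_univ, if_true]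
      by_cases hgh : g = h
      · simp [hgh]
      · simp [hgh, Ne.symm hgh, hq]

/-- The hermitian product sees only the coefficient at the identity of `u * hermAdj τ v`. Replacing
`u` by `g⁻¹ * u`, which stays in the left ideal, moves the coefficient at `g` there, so the whole
product vanishes. -/
theorem isHermSelfOrthogonal_iff (hτ : ∀ k, τ k = k ^ q) (hq : q ≠ 0)
    (I : Ideal (MonoidAlgebra F G)) :
    IsHermSelfOrthogonal q I ↔ I ∈ isotropicIdeals (hermAdj τ) := by
  simp only [IsHermSelfOrthogonal, isotropicIdeals, Set.mem_ofPred_eq, hermDual,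
    Set.subset_def, SetLike.mem_coe, hermInner_eq hτ hq]
  constructor
  · intro h u hu v hv
    ext g
    have := h v hv (MonoidAlgebra.single g⁻¹ 1 * u) (I.mul_mem_left _ hu)
    rw [mul_assoc, MonoidAlgebra.coeff_single_mul_eq_mul_coeff (m₂ := g)
      (H := fun m' _ => by rw [inv_mul_eq_one, eq_comm]), one_mul] at this
    simpa using this
  · intro h v hv u hu
    rw [h u hu v hv]
    rfl

end HermAdj

/-! ### Normal form u(r) + v(r)s and its behaviour under the adjoint -/

section Decomposition

variable {F : Type*} [Field F] {n : ℕ}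

theorem exists_polynomial_pair [NeZero n] (x : MonoidAlgebra F (DihedralGroup n)) :
    ∃ u v : F[X], u.degree < n ∧ v.degree < n ∧
      x = aeval (MonoidAlgebra.single (.r 1) 1) u +
        aeval (MonoidAlgebra.single (.r 1) 1) v * MonoidAlgebra.single (.sr 0) 1 := by
  have hpow : ∀ k : ℕ, (MonoidAlgebra.single (DihedralGroup.r 1) 1 :
      MonoidAlgebra F (DihedralGroup n)) ^ k = MonoidAlgebra.single (.r k) 1 := by
    intro k
    rw [MonoidAlgebra.single_pow, one_pow, DihedralGroup.r_one_pow]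
  have hdeg : ∀ (i : ZMod n) (k : F), (monomial i.val k).degree < n := fun i k =>
    (degree_monomial_le _ _).trans_lt (by exact_mod_cast ZMod.val_lt i)
  induction x using MonoidAlgebra.induction_linear with
  | zero => exact ⟨0, 0, by simp, by simp, by simp⟩
  | add x y hx hy =>
    obtain ⟨u, v, hu, hv, rfl⟩ := hx
    obtain ⟨u', v', hu', hv', rfl⟩ := hy
    refine ⟨u + u', v + v', (degree_add_le _ _).trans_lt (max_lt hu hu'),
      (degree_add_le _ _).trans_lt (max_lt hv hv'), ?_⟩
    simp only [map_add, add_mul]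
    abel
  | single g k =>
    cases g with
    | r i =>
      refine ⟨monomial i.val k, 0, hdeg _ _, by simp, ?_⟩
      rw [aeval_monomial, hpow, MonoidAlgebra.coe_algebraMap]
      simp [MonoidAlgebra.single_mul_single]
    | sr i =>
      -- In the dihedral group `sr i = r (-i) * sr 0`.
      refine ⟨0, monomial (-i).val k, by simp, hdeg _ _, ?_⟩
      rw [aeval_monomial, hpow, MonoidAlgebra.coe_algebraMap]
      simp [MonoidAlgebra.single_mul_single]

theorem hermAdj_aeval (τ : F →+* F) (u : F[X]) :
    hermAdj τ (aeval (MonoidAlgebra.single (.r 1) 1 : MonoidAlgebra F (DihedralGroup n)) u) =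
      aeval (MonoidAlgebra.single (.r (-1)) 1) (u.map τ) := by
  induction u using Polynomial.induction_on' with
  | add p q hp hq => simp only [map_add, hermAdj_add, hp, hq, Polynomial.map_add]
  | monomial k c =>
    rw [map_monomial, aeval_monomial, aeval_monomial, MonoidAlgebra.single_pow,
      MonoidAlgebra.single_pow, MonoidAlgebra.coe_algebraMap]
    simp [MonoidAlgebra.single_mul_single]

theorem single_sr_mul_aeval (u : F[X]) :
    (MonoidAlgebra.single (.sr 0) 1 : MonoidAlgebra F (DihedralGroup n)) *
      aeval (MonoidAlgebra.single (.r (-1)) 1) u =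
      aeval (MonoidAlgebra.single (.r 1) 1) u * MonoidAlgebra.single (.sr 0) 1 := by
  induction u using Polynomial.induction_on' with
  | add p q hp hq => simp only [map_add, mul_add, add_mul, hp, hq]
  | monomial k c =>
    rw [aeval_monomial, aeval_monomial, MonoidAlgebra.single_pow,
      MonoidAlgebra.single_pow, MonoidAlgebra.coe_algebraMap]
    simp [MonoidAlgebra.single_mul_single]

/-- The adjoint inverts `r`, but moving the reflection back to the right inverts it again; so only
the pure rotation part changes its argument. -/
theorem hermAdj_polynomial_pair (τ : F →+* F) (u v : F[X]) :
    hermAdj τ (aeval (MonoidAlgebra.single (.r 1) 1 : MonoidAlgebra F (DihedralGroup n)) u +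
      aeval (MonoidAlgebra.single (.r 1) 1) v * MonoidAlgebra.single (.sr 0) 1) =
    aeval (MonoidAlgebra.single (.r (-1)) 1) (u.map τ) +
      aeval (MonoidAlgebra.single (.r 1) 1) (v.map τ) * MonoidAlgebra.single (.sr 0) 1 := by
  rw [hermAdj_add, hermAdj_mul, hermAdj_aeval, hermAdj_aeval, hermAdj_single, map_one,
    DihedralGroup.inv_sr, single_sr_mul_aeval]

variable [NeZero n] {B : Type*} [Ring B] [Algebra F B] {α β : B} (hα : α ^ n = 1) (hβ : β * β = 1)
  (h : α * β * α = β)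

/-- The representation of the group algebra determined by the images of the generators. -/
noncomputable def dihedralRep : MonoidAlgebra F (DihedralGroup n) →ₐ[F] B :=
  MonoidAlgebra.lift F B _ (dihedralHom α β hα hβ h)

theorem dihedralRep_r_one : dihedralRep hα hβ h (MonoidAlgebra.single (.r 1) (1 : F)) = α := by
  rw [dihedralRep, MonoidAlgebra.lift_single, dihedralHom_r, one_smul, ZMod.val_one_eq_one_mod,
    ← pow_eq_pow_mod _ hα, pow_one]

theorem dihedralRep_sr_zero :
    dihedralRep hα hβ h (MonoidAlgebra.single (.sr 0) (1 : F)) = β := by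
  simp [dihedralRep, MonoidAlgebra.lift_single]

theorem dihedralRep_polynomial_pair (u v : F[X]) :
    dihedralRep hα hβ h (aeval (MonoidAlgebra.single (.r 1) (1 : F)) u +
      aeval (MonoidAlgebra.single (.r 1) (1 : F)) v * MonoidAlgebra.single (.sr 0) (1 : F)) =
    aeval α u + aeval α v * β := by
  rw [map_add, map_mul, ← aeval_algHom_apply, ← aeval_algHom_apply, dihedralRep_r_one,
    dihedralRep_sr_zero]

theorem dihedralRep_hermAdj_polynomial_pair (τ : F →+* F) {α' : B} (hα' : α' * α = 1)
    (u v : F[X]) :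
    dihedralRep hα hβ h (hermAdj τ (aeval (MonoidAlgebra.single (.r 1) (1 : F)) u +
      aeval (MonoidAlgebra.single (.r 1) (1 : F)) v * MonoidAlgebra.single (.sr 0) (1 : F))) =
    aeval α' (u.map τ) + aeval α (v.map τ) * β := by
  have hinv : dihedralRep hα hβ h (MonoidAlgebra.single (.r (-1)) (1 : F)) = α' := by
    have h1 : α * dihedralRep hα hβ h (MonoidAlgebra.single (.r (-1)) (1 : F)) = 1 := by
      have h2 := congrArg (dihedralRep hα hβ h)
        (MonoidAlgebra.single_mul_single (DihedralGroup.r (1 : ZMod n)) (.r (-1)) (1 : F) 1)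
      rw [map_mul, dihedralRep_r_one, DihedralGroup.r_mul_r, add_neg_cancel,
        DihedralGroup.r_zero, mul_one, ← MonoidAlgebra.one_def, map_one] at h2
      exact h2
    exact (left_inv_eq_right_inv hα' h1).symm
  rw [hermAdj_polynomial_pair, map_add, map_mul, ← aeval_algHom_apply, ← aeval_algHom_apply,
    dihedralRep_r_one, dihedralRep_sr_zero, hinv]

/-- A semilinear anti-endomorphism compatible with the generators intertwines the adjoint. -/
theorem dihedralRep_hermAdj (τ : F →+* F) (s : B →+ B) (hs : ∀ x y, s (x * y) = s y * s x)
    (hsk : ∀ k : F, s (algebraMap F B k) = algebraMap F B (τ k)) (hsα : s α * α = 1)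
    (hsβ : s β = β) (x : MonoidAlgebra F (DihedralGroup n)) :
    dihedralRep hα hβ h (hermAdj τ x) = s (dihedralRep hα hβ h x) := by
  have hs1 : s 1 = 1 := by simpa using hsk 1
  have hpow : ∀ k : ℕ, s (α ^ k) = s α ^ k := by
    intro k
    induction k with
    | zero => simpa using hs1
    | succ k ih => rw [pow_succ, hs, ih, ← pow_succ']
  have key : ∀ w : F[X], s (aeval α w) = aeval (s α) (w.map τ) := by
    intro w
    induction w using Polynomial.induction_on' with
    | add p q hp hq => simp only [map_add, hp, hq, Polynomial.map_add]
    | monomial k c =>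
      rw [map_monomial, aeval_monomial, aeval_monomial, hs, hpow, hsk, Algebra.commutes]
  have hcomm : β * s α = α * β := by
    have h2 : α * s α = 1 := by
      have : α * α ^ (n - 1) = 1 := by
        rw [← pow_succ', Nat.sub_add_cancel (NeZero.one_le), hα]
      rw [left_inv_eq_right_inv hsα this, this]
    calc β * s α = (α * β * α) * s α := by rw [h]
      _ = α * β := by rw [mul_assoc, h2, mul_one]
  have hswap : ∀ w : F[X], β * aeval (s α) w = aeval α w * β := by
    intro w
    have hk : ∀ k : ℕ, β * s α ^ k = α ^ k * β := fun k =>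
      (SemiconjBy.pow_right (show SemiconjBy β (s α) α from hcomm) k)
    induction w using Polynomial.induction_on' with
    | add p q hp hq => simp only [map_add, mul_add, add_mul, hp, hq]
    | monomial k c =>
      rw [aeval_monomial, aeval_monomial, ← mul_assoc, ← Algebra.commutes, mul_assoc, hk,
        mul_assoc]
  obtain ⟨u, v, -, -, rfl⟩ := exists_polynomial_pair x
  rw [dihedralRep_hermAdj_polynomial_pair hα hβ h τ hsα, dihedralRep_polynomial_pair, map_add,
    hs, hsβ, key, key, hswap]

end Decomposition

/-! ### Roots of reciprocal and conjugate polynomials -/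

section Polynomials

variable {F : Type*} [Field F]

theorem conj_eq_map {q : ℕ} {τ : F →+* F} (hτ : ∀ k, τ k = k ^ q) (g : F[X]) :
    conj q g = g.map τ := by
  conv_rhs => rw [g.as_sum_range_C_mul_X_pow, Polynomial.map_sum]
  simp [conj, hτ]

theorem map_map_involutive {τ : F →+* F} (hτ : ∀ k, τ (τ k) = k) (g : F[X]) :
    (g.map τ).map τ = g := by
  rw [Polynomial.map_map]
  convert Polynomial.map_id
  ext k
  exact hτ k

theorem aeval_recip_eq_zero {K : Type*} [Field K] [Algebra F K] {g : F[X]} (hg : g.coeff 0 ≠ 0)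
    {z : K} (hz : z ≠ 0) : aeval z (recip g) = 0 ↔ aeval z⁻¹ g = 0 := by
  have := invertibleOfNonzero (inv_ne_zero hz)
  have h := eval₂_reverse_eq_zero_iff (algebraMap F K) z⁻¹ g
  rw [invOf_eq_inv, inv_inv] at h
  rw [recip, map_mul, aeval_C, mul_eq_zero, or_iff_right]
  · exact h
  · simpa using hg

theorem ne_zero_of_aeval_recip_eq_zero {K : Type*} [Field K] [Algebra F K] {g : F[X]}
    (hg : g.coeff 0 ≠ 0) {z : K} (h : aeval z (recip g) = 0) : z ≠ 0 := by
  rintro rfl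
  have hg0 : g ≠ 0 := by rintro rfl; simp at hg
  rw [← coeff_zero_eq_aeval_zero'] at h
  simp [recip, hg, hg0] at h

theorem natDegree_recip {g : F[X]} (hg : g.coeff 0 ≠ 0) : (recip g).natDegree = g.natDegree := by
  rw [recip, natDegree_C_mul (inv_ne_zero hg), reverse_natDegree,
    natTrailingDegree_eq_zero.2 (Or.inr hg), Nat.sub_zero]

theorem recip_ne_zero {g : F[X]} (hg : g.coeff 0 ≠ 0) : recip g ≠ 0 := by
  have hg0 : g ≠ 0 := by rintro rfl; simp at hg
  simp [recip, hg, hg0]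

theorem aeval_map_semilinear {K : Type*} [Field K] [Algebra F K] {τ : F →+* F} {c : K →+* K}
    (hc : ∀ k, c (algebraMap F K k) = algebraMap F K (τ k)) (z : K) (g : F[X]) :
    aeval (c z) (g.map τ) = c (aeval z g) := by
  rw [aeval_def, aeval_def, eval₂_map, hom_eval₂]
  congr 1
  ext k
  exact (hc k).symm

end Polynomials

/-! ### The two-dimensional representation attached to a root of unity -/

section Representations

variable {F : Type*} [Field F] {n : ℕ} {E : Type*} [Field E] [Algebra F E] {θ : E}

theorem diagonal_pow_eq_one (hθ : θ ^ n = 1) : (!![θ, 0; 0, θ⁻¹] : Matrix _ _ E) ^ n = 1 := by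
  have : (!![θ, 0; 0, θ⁻¹] : Matrix _ _ E) = Matrix.diagonal ![θ, θ⁻¹] := by
    ext i j; fin_cases i <;> fin_cases j <;> rfl
  rw [this, Matrix.diagonal_pow, ← Matrix.diagonal_one]
  congr 1
  ext i
  fin_cases i <;> simp [hθ]

theorem swap_mul_swap : (!![0, 1; 1, 0] : Matrix _ _ E) * !![0, 1; 1, 0] = 1 := by
  simp [Matrix.one_fin_two]

theorem diagonal_mul_swap_mul_diagonal (hθ : θ ≠ 0) :
    (!![θ, 0; 0, θ⁻¹] : Matrix _ _ E) * !![0, 1; 1, 0] * !![θ, 0; 0, θ⁻¹] = !![0, 1; 1, 0] := by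
  simp [hθ]

variable [NeZero n]

theorem ne_zero_of_pow_eq_one (hθ : θ ^ n = 1) : θ ≠ 0 := by
  rintro rfl
  rw [zero_pow (NeZero.ne n)] at hθ
  exact zero_ne_one hθ

/-- The two-dimensional representation in which the rotation has eigenvalues `θ` and `θ⁻¹`. -/
noncomputable def planeRep (hθ : θ ^ n = 1) :
    MonoidAlgebra F (DihedralGroup n) →ₐ[F] Matrix (Fin 2) (Fin 2) E :=
  dihedralRep (diagonal_pow_eq_one hθ) swap_mul_swap
    (diagonal_mul_swap_mul_diagonal (ne_zero_of_pow_eq_one hθ))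

theorem aeval_diagonal (x y : E) (u : F[X]) :
    aeval (!![x, 0; 0, y] : Matrix _ _ E) u = !![aeval x u, 0; 0, aeval y u] := by
  induction u using Polynomial.induction_on' with
  | add p q hp hq => simp [map_add, hp, hq]
  | monomial k c =>
    have : (!![x, 0; 0, y] : Matrix _ _ E) ^ k = !![x ^ k, 0; 0, y ^ k] := by
      induction k with
      | zero => simp [Matrix.one_fin_two]
      | succ k ih => rw [pow_succ, ih]; simp [pow_succ]
    rw [aeval_monomial, aeval_monomial, aeval_monomial, this]
    ext i j
    fin_cases i <;> fin_cases j <;> simp [Matrix.algebraMap_matrix_apply, Matrix.mul_apply]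

theorem planeRep_polynomial_pair (hθ : θ ^ n = 1) (u v : F[X]) :
    planeRep hθ (aeval (MonoidAlgebra.single (.r 1) (1 : F)) u +
      aeval (MonoidAlgebra.single (.r 1) (1 : F)) v * MonoidAlgebra.single (.sr 0) (1 : F)) =
    !![aeval θ u, aeval θ v; aeval θ⁻¹ v, aeval θ⁻¹ u] := by
  rw [planeRep, dihedralRep_polynomial_pair, aeval_diagonal, aeval_diagonal]
  simp

theorem planeRep_hermAdj_polynomial_pair (hθ : θ ^ n = 1) (τ : F →+* F) (u v : F[X]) :
    planeRep hθ (hermAdj τ (aeval (MonoidAlgebra.single (.r 1) (1 : F)) u +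
      aeval (MonoidAlgebra.single (.r 1) (1 : F)) v * MonoidAlgebra.single (.sr 0) (1 : F))) =
    !![aeval θ⁻¹ (u.map τ), aeval θ (v.map τ); aeval θ⁻¹ (v.map τ), aeval θ (u.map τ)] := by
  have hθ0 := ne_zero_of_pow_eq_one hθ
  rw [planeRep, dihedralRep_hermAdj_polynomial_pair _ _ _ τ (α' := !![θ⁻¹, 0; 0, θ])
    (by simp [hθ0, Matrix.one_fin_two]), aeval_diagonal, aeval_diagonal]
  simp

end Representations

/-! ### Components of the group algebra -/

section Components

variable {F : Type*} [Field F] {n : ℕ}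

/-- `φ` is a homomorphism from the group algebra to a ring with adjoint `s` with `N` isotropic
left ideals, cutting out the part of the group algebra that belongs to the factor `g` of
`X ^ n - 1`. -/
structure IsComponent (τ : F →+* F) {B : Type*} [Ring B]
    (φ : MonoidAlgebra F (DihedralGroup n) →+* B) (s : B → B) (g : F[X]) (N : ℕ) : Prop where
  map_hermAdj : ∀ x, φ (hermAdj τ x) = s (φ x)
  card : Nat.card B = Nat.card F ^ (2 * g.natDegree)
  count : (isotropicIdeals s).ncard = N
  vanish : ∀ u v : F[X], φ (aeval (MonoidAlgebra.single (.r 1) (1 : F)) u +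
    aeval (MonoidAlgebra.single (.r 1) (1 : F)) v * MonoidAlgebra.single (.sr 0) (1 : F)) = 0 →
    ∀ z : AlgebraicClosure F, aeval z g = 0 → aeval z u = 0 ∧ aeval z v = 0

variable {τ : F →+* F}

/-- A representation by `2 × 2` matrices, together with its adjoint, gives a component on which
the adjoint exchanges the two factors. -/
theorem isComponent_prod (hτ : ∀ k, τ (τ k) = k) {L : Type*} [Field L] [Finite L]
    (φ : MonoidAlgebra F (DihedralGroup n) →+* Matrix (Fin 2) (Fin 2) L) (g : F[X])
    (hcard : Nat.card L ^ 8 = Nat.card F ^ (2 * g.natDegree))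
    (hvan : ∀ x : MonoidAlgebra F (DihedralGroup n), ∀ u v : F[X],
      x = aeval (MonoidAlgebra.single (.r 1) (1 : F)) u +
        aeval (MonoidAlgebra.single (.r 1) (1 : F)) v * MonoidAlgebra.single (.sr 0) (1 : F) →
      φ x = 0 → φ (hermAdj τ x) = 0 →
      ∀ z : AlgebraicClosure F, aeval z g = 0 → aeval z u = 0 ∧ aeval z v = 0) :
    IsComponent τ (φ.prod (((Matrix.transposeRingEquiv (Fin 2) L).symm.toRingHom.comp
      φ.op).comp (hermAdjOp τ)))
      (fun x => (x.2.transpose, x.1.transpose)) g (3 * Nat.card L + 6) where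
  -- The second coordinate is `x ↦ (φ (hermAdj τ x))ᵀ`, a homomorphism since both operations reverse
  -- products. As `hermAdj τ` is an involution, it swaps the two coordinates up to transposition.
  map_hermAdj x := by
    refine Prod.ext ?_ ?_
    · change φ (hermAdj τ x) = (φ (hermAdj τ x)).transpose.transpose
      rw [Matrix.transpose_transpose]
    · change (φ (hermAdj τ (hermAdj τ x))).transpose = (φ x).transpose
      rw [hermAdj_hermAdj τ hτ]
  card := by
    have : Nat.card (Matrix (Fin 2) (Fin 2) L) = Nat.card L ^ 4 := by
      rw [Matrix, Nat.card_fun, Nat.card_fun, Nat.card_fin, ← pow_mul]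
    rw [Nat.card_prod, this, ← hcard]
    ring
  count := by
    rw [ncard_isotropicIdeals_prod Matrix.transpose Matrix.transpose_zero
      (fun x y => by simp), ncard_idealPairs_matrix, ncard_orthogonalPairs]
  vanish u v h := by
    refine hvan _ u v rfl (congrArg Prod.fst h) ?_
    have := congrArg Prod.snd h
    exact Matrix.transpose_eq_zero.1 this

end Components

/-! ### Counting for unitary adjoints -/

section UnitaryCount

variable {E : Type*} [Field E] [Finite E]

/-- The right-hand factor `P` is invertible and can be cancelled, leaving `M * P * (c N)ᵀ = 0`,
whose entries are the values of the form `u ⬝ᵥ P (c v)` on rows. The form is nonzero because `P` is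
invertible. -/
theorem ncard_isotropicIdeals_unitary (c : E →+* E) (P : Matrix (Fin 2) (Fin 2) E)
    (hP : P * P = 1) {N : ℕ}
    (hN : {p : Option E | lineGen p ⬝ᵥ P.mulVec (c ∘ lineGen p) = 0}.ncard = N) :
    (isotropicIdeals fun M => P * (M.map c).transpose * P).ncard = N + 1 := by
  rw [ncard_isotropicIdeals_matrix _ (fun u v => u ⬝ᵥ P.mulVec (c ∘ v)),
    ncard_isotropicSubspaces c, hN]
  · intro a d u v
    have : c ∘ (d • v) = c d • (c ∘ v) := by ext i; simp
    rw [this, Matrix.mulVec_smul, smul_dotProduct, dotProduct_smul, smul_eq_mul, smul_eq_mul,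
      mul_assoc]
  · by_contra! h
    have hc : c ∘ (Pi.single 0 1 : Fin 2 → E) = Pi.single 0 1 := by
      ext j; fin_cases j <;> simp
    have h0 : P.mulVec (Pi.single 0 1) = 0 := by
      ext i
      have := h (Pi.single i 1) (Pi.single 0 1)
      rw [hc, single_one_dotProduct] at this
      exact this
    have h1 := congrArg P.mulVec h0
    rw [Matrix.mulVec_mulVec, hP, Matrix.one_mulVec, Matrix.mulVec_zero] at h1
    simpa using congrFun h1 0
  · intro M N
    have : M * (P * (N.map c).transpose * P) = 0 ↔ M * (P * (N.map c).transpose) = 0 := by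
      constructor
      · intro h
        have := congrArg (· * P) h
        simpa [mul_assoc, hP] using this
      · intro h
        rw [← mul_assoc, h, zero_mul]
    rw [this, ← Matrix.ext_iff]
    rfl

variable {Q p k : ℕ} [ExpChar E p]

theorem ncard_isotropicIdeals_unitary_one (hQ : Nat.card E = Q ^ 2) (hp : Q = p ^ k)
    (c : E →+* E) (hc : ∀ x, c x = x ^ Q) :
    (isotropicIdeals fun M : Matrix (Fin 2) (Fin 2) E =>
      1 * (M.map c).transpose * 1).ncard = Q + 2 := by
  apply ncard_isotropicIdeals_unitary c 1 (one_mul 1)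
  rw [← ncard_norm_isotropic hQ hp, ← Set.ncard_image_of_injective _ (Option.some_injective E)]
  congr 1
  ext p
  cases p <;> simp [hc]

theorem ncard_isotropicIdeals_unitary_swap (hQ : Nat.card E = Q ^ 2) (hp : Q = p ^ k)
    (c : E →+* E) (hc : ∀ x, c x = x ^ Q) :
    (isotropicIdeals fun M : Matrix (Fin 2) (Fin 2) E =>
      !![0, 1; 1, 0] * (M.map c).transpose * !![0, 1; 1, 0]).ncard = Q + 2 := by
  have hQ0 : Q ≠ 0 := by
    rintro rfl
    exact Nat.card_pos.ne' (hQ.trans (zero_pow two_ne_zero))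
  apply ncard_isotropicIdeals_unitary c _ swap_mul_swap
  -- The form is `u₀ c(v₁) + u₁ c(v₀)`: the line through `(0, 1)` is isotropic, and the line through
  -- `(1, t)` is so when `t` has trace zero.
  have hset : {p : Option E | lineGen p ⬝ᵥ
      (!![0, 1; 1, 0] : Matrix (Fin 2) (Fin 2) E).mulVec (c ∘ lineGen p) = 0} =
      insert none (some '' {t : E | t + t ^ Q = 0}) := by
    ext p
    cases p <;> simp [hc, hQ0, Matrix.vecHead, Matrix.vecTail, add_comm]
  rw [hset, Set.ncard_insert_of_notMem (by simp) (Set.toFinite _),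
    Set.ncard_image_of_injective _ (Option.some_injective E), ncard_trace_isotropic hQ hp]

end UnitaryCount

/-! ### The field generated by a root of an irreducible factor -/

section RootFields

variable {F : Type*} [Field F] {f : F[X]}

theorem natCard_adjoinRoot (hf : f ≠ 0) :
    Nat.card (AdjoinRoot f) = Nat.card F ^ f.natDegree := by
  have := (AdjoinRoot.powerBasis hf).finite
  rw [Module.natCard_eq_pow_finrank (K := F), (AdjoinRoot.powerBasis hf).finrank,
    AdjoinRoot.powerBasis_dim]

theorem finite_adjoinRoot [Finite F] (hf : f ≠ 0) : Finite (AdjoinRoot f) := by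
  have := (AdjoinRoot.powerBasis hf).finite
  exact Module.finite_of_finite F

theorem aeval_root_eq_zero : aeval (AdjoinRoot.root f) f = 0 := by
  rw [AdjoinRoot.aeval_eq, AdjoinRoot.mk_self]

theorem aeval_eq_zero_of_aeval_root {K : Type*} [Field K] [Algebra F K] {y : K} (hy : aeval y f = 0)
    {w : F[X]} (hw : aeval (AdjoinRoot.root f) w = 0) : aeval y w = 0 := by
  rw [AdjoinRoot.aeval_eq, AdjoinRoot.mk_eq_zero] at hw
  exact aeval_eq_zero_of_dvd_aeval_eq_zero hw hy

theorem coeff_zero_ne_zero {n : ℕ} [NeZero n] (h : f ∣ X ^ n - 1) : f.coeff 0 ≠ 0 := by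
  intro h0
  obtain ⟨g, hg⟩ := h
  have := congrArg (fun p => coeff p 0) hg
  simp only [mul_coeff_zero, h0, zero_mul] at this
  simp [(NeZero.ne n).symm] at this

variable [Fact (Irreducible f)]

theorem aeval_inv_eq_zero_of_aeval_root_inv {K : Type*} [Field K] [Algebra F K] {y : K} (hy : aeval y f = 0)
    {w : F[X]} (hw : aeval (AdjoinRoot.root f)⁻¹ w = 0) : aeval y⁻¹ w = 0 := by
  let ψ := AdjoinRoot.liftAlgHom f (Algebra.ofId F K) y hy
  have hψ : ψ (AdjoinRoot.root f) = y := AdjoinRoot.liftAlgHom_root _ _ _ _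
  rw [← hψ, ← map_inv₀, aeval_algHom_apply, hw, map_zero]

theorem root_pow_eq_one {n : ℕ} (h : f ∣ X ^ n - 1) : AdjoinRoot.root f ^ n = 1 := by
  have := aeval_eq_zero_of_dvd_aeval_eq_zero h aeval_root_eq_zero
  simpa [sub_eq_zero] using this

/-- An involution of the root field, semilinear with respect to `τ`. -/
theorem exists_semilinear_involution {τ : F →+* F} (hτ : ∀ k, τ (τ k) = k)
    (x : AdjoinRoot f) (hx : aeval x (f.map τ) = 0)
    (hxx : x = AdjoinRoot.root f ∨ x = (AdjoinRoot.root f)⁻¹) :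
    ∃ c : AdjoinRoot f →+* AdjoinRoot f, c (AdjoinRoot.root f) = x ∧
      (∀ k, c (algebraMap F _ k) = algebraMap F _ (τ k)) ∧ ∀ y, c (c y) = y := by
  let c : AdjoinRoot f →+* AdjoinRoot f :=
    AdjoinRoot.lift ((algebraMap F (AdjoinRoot f)).comp τ) x
      (by rwa [aeval_def, eval₂_map] at hx)
  have h1 : c (AdjoinRoot.root f) = x := AdjoinRoot.lift_root _
  have h2 : ∀ k, c (algebraMap F _ k) = algebraMap F _ (τ k) := fun k =>
    AdjoinRoot.lift_of _
  refine ⟨c, h1, h2, fun y => ?_⟩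
  have : c.comp c = RingHom.id _ := by
    refine AdjoinRoot.ringHom_ext ?_ ?_
    · ext k
      change c (c (algebraMap F _ k)) = algebraMap F _ k
      rw [h2, h2, hτ]
    · change c (c (AdjoinRoot.root f)) = AdjoinRoot.root f
      rcases hxx with rfl | rfl
      · rw [h1, h1]
      · rw [h1, map_inv₀, h1, inv_inv]
  exact DFunLike.congr_fun this y

/-- Here `θ ^ 2 = 1`, so `θ = ±1` lies in `F`, and an irreducible polynomial with a root in the base
field is linear. -/
theorem eq_X_sub_C_of_root_eq_inv (hm : f.Monic) (h0 : AdjoinRoot.root f ≠ 0)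
    (h : AdjoinRoot.root f = (AdjoinRoot.root f)⁻¹) :
    f = X - C 1 ∨ f = X - C (-1) := by
  have hlin : ∀ e : F, AdjoinRoot.root f = algebraMap F _ e → f = X - C e := by
    intro e he
    have h1 : algebraMap F (AdjoinRoot f) (f.eval e) = 0 := by
      have := aeval_root_eq_zero (f := f)
      rwa [he, aeval_algebraMap_apply_eq_algebraMap_eval] at this
    have h2 : f.eval e = 0 := (map_eq_zero _).1 h1
    have hirr : Irreducible f := Fact.out
    exact (eq_of_monic_of_associated (monic_X_sub_C e) hm
      ((irreducible_X_sub_C e).associated_of_dvd hirr (dvd_iff_isRoot.2 h2))).symm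
  have h2 : AdjoinRoot.root f * AdjoinRoot.root f = 1 := by
    nth_rewrite 2 [h]
    exact mul_inv_cancel₀ h0
  rcases mul_self_eq_one_iff.1 h2 with h3 | h3
  · left; exact hlin 1 (by rw [h3, map_one])
  · right; exact hlin (-1) (by rw [h3, map_neg, map_one])

end RootFields

/-! ### Components for each class of factors -/

section ComponentsOfFactors

universe w

variable {F : Type w} [Field F] {n : ℕ} {τ : F →+* F} {f : F[X]}

/-- There is a component for the factor `g` with `N` isotropic left ideals. -/
def HasComponent (n : ℕ) (τ : F →+* F) (g : F[X]) (N : ℕ) : Prop :=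
  ∃ (B : Type w) (_ : Ring B) (φ : MonoidAlgebra F (DihedralGroup n) →+* B) (s : B → B),
    IsComponent τ φ s g N

/-- Applying the injective `σ` conjugates the coefficients once more, which restores `g`. Only `τ`
has to be an involution; an extension `σ` to the algebraic closure need not be one. -/
theorem aeval_map_eq_zero_iff (hτ : ∀ k, τ (τ k) = k)
    {σ : AlgebraicClosure F →+* AlgebraicClosure F}
    (hσ : ∀ k, σ (algebraMap F _ k) = algebraMap F _ (τ k)) {z : AlgebraicClosure F} {g : F[X]} :
    aeval z (g.map τ) = 0 ↔ aeval (σ z) g = 0 := by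
  rw [← map_eq_zero σ, ← aeval_map_semilinear hσ, map_map_involutive hτ]

theorem aeval_eq_zero_of_map {σ : AlgebraicClosure F →+* AlgebraicClosure F}
    (hσ : ∀ k, σ (algebraMap F _ k) = algebraMap F _ (τ k)) {z : AlgebraicClosure F} {g : F[X]}
    (h : aeval (σ z) (g.map τ) = 0) : aeval z g = 0 := by
  rwa [aeval_map_semilinear hσ, map_eq_zero] at h

variable [NeZero n]

/-- The component of a factor whose conjugates and reciprocals are all different. -/
theorem hasComponent_quadruple [Finite F] (hirr : Irreducible f) (hdvd : f ∣ X ^ n - 1)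
    (hτ : ∀ k, τ (τ k) = k) {σ : AlgebraicClosure F →+* AlgebraicClosure F}
    (hσ : ∀ k, σ (algebraMap F _ k) = algebraMap F _ (τ k)) :
    HasComponent n τ (f * recip f * f.map τ * (recip f).map τ)
      (3 * Nat.card F ^ f.natDegree + 6) := by
  have := Fact.mk hirr
  have := finite_adjoinRoot hirr.ne_zero
  have hc0 := coeff_zero_ne_zero hdvd
  have hr0 := recip_ne_zero hc0
  have hm0 : f.map τ ≠ 0 := (Polynomial.map_ne_zero_iff τ.injective).2 hirr.ne_zero
  have hmr0 : (recip f).map τ ≠ 0 := (Polynomial.map_ne_zero_iff τ.injective).2 hr0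
  have hθ := root_pow_eq_one hdvd
  rw [← natCard_adjoinRoot hirr.ne_zero]
  refine ⟨_, _, _, _, isComponent_prod hτ (planeRep hθ).toRingHom _ ?_ ?_⟩
  · rw [natDegree_mul (mul_ne_zero (mul_ne_zero hirr.ne_zero hr0) hm0) hmr0,
      natDegree_mul (mul_ne_zero hirr.ne_zero hr0) hm0, natDegree_mul hirr.ne_zero hr0,
      natDegree_map, natDegree_map, natDegree_recip hc0, natCard_adjoinRoot hirr.ne_zero,
      ← pow_mul]
    congr 1; ring
  · rintro _ u v rfl h1 h2 z hz
    -- The entries for `x` give the vanishing of `u, v` at `θ` and `θ⁻¹`, those for its adjoint the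
    -- vanishing of their conjugates there. Together these cover the roots of all four factors.
    have h1' : (!![_, _; _, _] : Matrix _ _ _) = 0 :=
      (planeRep_polynomial_pair hθ u v).symm.trans h1
    have h2' : (!![_, _; _, _] : Matrix _ _ _) = 0 :=
      (planeRep_hermAdj_polynomial_pair hθ τ u v).symm.trans h2
    have a00 := congrFun (congrFun h1' 0) 0
    have a01 := congrFun (congrFun h1' 0) 1
    have a10 := congrFun (congrFun h1' 1) 0
    have a11 := congrFun (congrFun h1' 1) 1
    have b00 := congrFun (congrFun h2' 0) 0
    have b01 := congrFun (congrFun h2' 0) 1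
    have b10 := congrFun (congrFun h2' 1) 0
    have b11 := congrFun (congrFun h2' 1) 1
    simp only [Matrix.of_apply, Matrix.cons_val', Matrix.cons_val_zero, Matrix.cons_val_one,
      Matrix.cons_val_fin_one, Matrix.zero_apply] at a00 a01 a10 a11 b00 b01 b10 b11
    simp only [map_mul, mul_eq_zero] at hz
    rcases hz with ((hz | hz) | hz) | hz
    · exact ⟨aeval_eq_zero_of_aeval_root hz a00, aeval_eq_zero_of_aeval_root hz a01⟩
    · have hz0 := ne_zero_of_aeval_recip_eq_zero hc0 hz
      rw [aeval_recip_eq_zero hc0 hz0] at hz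
      rw [← inv_inv z]
      exact ⟨aeval_inv_eq_zero_of_aeval_root_inv hz a11, aeval_inv_eq_zero_of_aeval_root_inv hz a10⟩
    · rw [aeval_map_eq_zero_iff hτ hσ] at hz
      exact ⟨aeval_eq_zero_of_map hσ (aeval_eq_zero_of_aeval_root hz b11),
        aeval_eq_zero_of_map hσ (aeval_eq_zero_of_aeval_root hz b01)⟩
    · rw [aeval_map_eq_zero_iff hτ hσ] at hz
      have hz0 := ne_zero_of_aeval_recip_eq_zero hc0 hz
      rw [aeval_recip_eq_zero hc0 hz0] at hz
      have e1 := aeval_inv_eq_zero_of_aeval_root_inv hz b00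
      have e2 := aeval_inv_eq_zero_of_aeval_root_inv hz b10
      rw [inv_inv] at e1 e2
      exact ⟨aeval_eq_zero_of_map hσ e1, aeval_eq_zero_of_map hσ e2⟩

/-- A plane representation with a unitary adjoint gives a component. -/
theorem isComponent_unitary (hirr : Irreducible f) [Fact (Irreducible f)]
    (hdvd : f ∣ X ^ n - 1)
    (c : AdjoinRoot f →+* AdjoinRoot f) (hcF : ∀ k, c (algebraMap F _ k) = algebraMap F _ (τ k))
    (P : Matrix (Fin 2) (Fin 2) (AdjoinRoot f)) (hP : P * P = 1)
    (hPα : P * !![c (AdjoinRoot.root f), 0; 0, (c (AdjoinRoot.root f))⁻¹] * P =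
      !![(AdjoinRoot.root f)⁻¹, 0; 0, AdjoinRoot.root f])
    (hPβ : P * !![0, 1; 1, 0] * P = !![0, 1; 1, 0]) {N : ℕ}
    (hN : (isotropicIdeals fun M => P * (M.map c).transpose * P).ncard = N) :
    IsComponent τ (planeRep (F := F) (root_pow_eq_one hdvd)).toRingHom
      (fun M => P * (M.map c).transpose * P) (f * recip f) N := by
  have hc0 := coeff_zero_ne_zero hdvd
  have hθ := root_pow_eq_one hdvd
  let s : Matrix (Fin 2) (Fin 2) (AdjoinRoot f) →+ Matrix (Fin 2) (Fin 2) (AdjoinRoot f) :=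
    { toFun := fun M => P * (M.map c).transpose * P
      map_zero' := by simp
      map_add' := fun M N => by
        rw [Matrix.map_add _ (map_add c), Matrix.transpose_add, mul_add, add_mul] }
  refine ⟨fun x => ?_, ?_, hN, ?_⟩
  -- Two semilinear anti-endomorphisms are compared on generators: `hPα` makes the adjoint invert
  -- the rotation, `hPβ` makes it fix the reflection.
  · refine dihedralRep_hermAdj _ _ _ τ s ?_ ?_ ?_ ?_ x
    · intro M N
      change P * ((M * N).map c).transpose * P =
        (P * (N.map c).transpose * P) * (P * (M.map c).transpose * P)
      rw [Matrix.map_mul, Matrix.transpose_mul]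
      simp only [mul_assoc]
      rw [← mul_assoc P P, hP, one_mul]
    · intro k
      change P * (((algebraMap F _ k : Matrix _ _ (AdjoinRoot f))).map c).transpose * P =
        algebraMap F _ (τ k)
      have : (((algebraMap F _ k : Matrix (Fin 2) (Fin 2) (AdjoinRoot f))).map c).transpose =
          algebraMap F _ (τ k) := by
        ext i j
        fin_cases i <;> fin_cases j <;>
          simp [Matrix.algebraMap_matrix_apply, -AdjoinRoot.algebraMap_eq, hcF]
      rw [this, ← Algebra.commutes, mul_assoc, hP, mul_one]
    · change P * (Matrix.map !![_, 0; 0, _] c).transpose * P * !![_, 0; 0, _] = 1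
      have : ((!![AdjoinRoot.root f, 0; 0, (AdjoinRoot.root f)⁻¹] : Matrix _ _ _).map c).transpose =
          !![c (AdjoinRoot.root f), 0; 0, (c (AdjoinRoot.root f))⁻¹] := by
        ext i j
        fin_cases i <;> fin_cases j <;> simp
      rw [this, hPα]
      simp [ne_zero_of_pow_eq_one hθ, Matrix.one_fin_two]
    · change P * (Matrix.map !![0, 1; 1, 0] c).transpose * P = !![0, 1; 1, 0]
      have : ((!![0, 1; 1, 0] : Matrix (Fin 2) (Fin 2) (AdjoinRoot f)).map c).transpose =
          !![0, 1; 1, 0] := by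
        ext i j
        fin_cases i <;> fin_cases j <;> simp
      rw [this, hPβ]
  · rw [Matrix, Nat.card_fun, Nat.card_fun, Nat.card_fin, natCard_adjoinRoot hirr.ne_zero,
      natDegree_mul hirr.ne_zero (recip_ne_zero hc0), natDegree_recip hc0, ← pow_mul, ← pow_mul]
    congr 1; ring
  · intro u v h1 z hz
    have h1' : (!![_, _; _, _] : Matrix _ _ _) = 0 :=
      (planeRep_polynomial_pair hθ u v).symm.trans h1
    have a00 := congrFun (congrFun h1' 0) 0
    have a01 := congrFun (congrFun h1' 0) 1
    have a10 := congrFun (congrFun h1' 1) 0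
    have a11 := congrFun (congrFun h1' 1) 1
    simp only [Matrix.of_apply, Matrix.cons_val', Matrix.cons_val_zero, Matrix.cons_val_one,
      Matrix.cons_val_fin_one, Matrix.zero_apply] at a00 a01 a10 a11
    simp only [map_mul, mul_eq_zero] at hz
    rcases hz with hz | hz
    · exact ⟨aeval_eq_zero_of_aeval_root hz a00, aeval_eq_zero_of_aeval_root hz a01⟩
    · have hz0 := ne_zero_of_aeval_recip_eq_zero hc0 hz
      rw [aeval_recip_eq_zero hc0 hz0] at hz
      rw [← inv_inv z]
      exact ⟨aeval_inv_eq_zero_of_aeval_root_inv hz a11, aeval_inv_eq_zero_of_aeval_root_inv hz a10⟩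

variable {q p m : ℕ} [ExpChar F p]

/-- The component of a factor that is self-conjugate, or whose conjugate is its reciprocal. -/
theorem hasComponent_unitary [Finite F] (hirr : Irreducible f) (hdvd : f ∣ X ^ n - 1)
    (hτ : ∀ k, τ (τ k) = k) (hne : ∃ k, τ k ≠ k) (hq : Nat.card F = q ^ 2) (hqp : q = p ^ m)
    (hf : f.map τ = f ∨ f.map τ = recip f) :
    HasComponent n τ (f * recip f) (q ^ f.natDegree + 2) := by
  have := Fact.mk hirr
  have := finite_adjoinRoot hirr.ne_zero
  have hc0 := coeff_zero_ne_zero hdvd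
  have hθ := root_pow_eq_one hdvd
  have hθ0 := ne_zero_of_pow_eq_one hθ
  have : ExpChar (AdjoinRoot f) p := expChar_of_injective_algebraMap
    (algebraMap F (AdjoinRoot f)).injective p
  have hcard : Nat.card (AdjoinRoot f) = (q ^ f.natDegree) ^ 2 := by
    rw [natCard_adjoinRoot hirr.ne_zero, hq, ← pow_mul, ← pow_mul, mul_comm]
  have hQp : q ^ f.natDegree = p ^ (m * f.natDegree) := by rw [hqp, pow_mul]
  have hcne : ∀ c : AdjoinRoot f →+* AdjoinRoot f,
      (∀ k, c (algebraMap F _ k) = algebraMap F _ (τ k)) → ∃ x, c x ≠ x := by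
    intro c hc
    obtain ⟨k, hk⟩ := hne
    refine ⟨algebraMap F _ k, ?_⟩
    rw [hc]
    exact fun h => hk ((algebraMap F (AdjoinRoot f)).injective h)
  rcases hf with hf | hf
  -- Here `c` fixes `θ`, so `P` must swap the coordinates to invert `diag(θ, θ⁻¹)`.
  · obtain ⟨c, hcθ, hcF, hcc⟩ := exists_semilinear_involution hτ (AdjoinRoot.root f)
      (by rw [hf, aeval_root_eq_zero]) (Or.inl rfl)
    have hcQ := involution_eq_pow hcard c hcc (hcne c hcF)
    exact ⟨_, _, _, _, isComponent_unitary hirr hdvd c hcF !![0, 1; 1, 0] swap_mul_swap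
      (by rw [hcθ]; simp) (by simp) (ncard_isotropicIdeals_unitary_swap hcard hQp c hcQ)⟩
  -- Here `c` itself inverts `θ`, so `P = 1` suffices.
  · obtain ⟨c, hcθ, hcF, hcc⟩ := exists_semilinear_involution hτ (AdjoinRoot.root f)⁻¹
      (by rw [hf, aeval_recip_eq_zero hc0 (inv_ne_zero hθ0), inv_inv, aeval_root_eq_zero])
      (Or.inr rfl)
    have hcQ := involution_eq_pow hcard c hcc (hcne c hcF)
    exact ⟨_, _, _, _, isComponent_unitary hirr hdvd c hcF 1 (one_mul 1)
      (by rw [hcθ]; simp) (by simp) (ncard_isotropicIdeals_unitary_one hcard hQp c hcQ)⟩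

/-- The automorphism of the root field of a self-reciprocal polynomial inverting the root. -/
theorem exists_root_inversion [Fact (Irreducible f)] (hc0 : f.coeff 0 ≠ 0) (hf : recip f = f) :
    ∃ e : AdjoinRoot f ≃ₐ[F] AdjoinRoot f, e (AdjoinRoot.root f) = (AdjoinRoot.root f)⁻¹ ∧
      ∀ x, e (e x) = x := by
  have hθ : aeval (AdjoinRoot.root f)⁻¹ f = 0 := by
    by_cases h0 : AdjoinRoot.root f = 0
    · rw [h0, inv_zero]
      simpa [h0] using aeval_root_eq_zero (f := f)
    · have := (aeval_recip_eq_zero hc0 (inv_ne_zero h0)).2 (by rw [inv_inv, aeval_root_eq_zero])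
      rwa [hf] at this
  let e : AdjoinRoot f →ₐ[F] AdjoinRoot f :=
    AdjoinRoot.liftAlgHom f (Algebra.ofId F _) (AdjoinRoot.root f)⁻¹ hθ
  have h1 : e (AdjoinRoot.root f) = (AdjoinRoot.root f)⁻¹ := AdjoinRoot.liftAlgHom_root _ _ _ _
  have h2 : e.comp e = AlgHom.id F _ := by
    refine AdjoinRoot.algHom_ext ?_
    change e (e (AdjoinRoot.root f)) = AdjoinRoot.root f
    rw [h1, map_inv₀, h1, inv_inv]
  exact ⟨AlgEquiv.ofAlgHom e e h2 h2, h1, DFunLike.congr_fun h2⟩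

/-- Otherwise the root field has two nontrivial involutions: one fixing `θ` and extending `τ`, one
inverting `θ` and fixing `F`. They must coincide, yet they differ on `F`. -/
theorem root_eq_inv_of_conj_eq_recip_eq [Finite F] [Fact (Irreducible f)] (hc0 : f.coeff 0 ≠ 0)
    (hτ : ∀ k, τ (τ k) = k) (hne : ∃ k, τ k ≠ k) (hq : Nat.card F = q ^ 2)
    (hf : f.map τ = f) (hf' : recip f = f) : AdjoinRoot.root f = (AdjoinRoot.root f)⁻¹ := by
  have hirr : Irreducible f := Fact.out
  have := finite_adjoinRoot hirr.ne_zero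
  have hcard : Nat.card (AdjoinRoot f) = (q ^ f.natDegree) ^ 2 := by
    rw [natCard_adjoinRoot hirr.ne_zero, hq, ← pow_mul, ← pow_mul, mul_comm]
  by_contra hθ
  obtain ⟨c, -, hcF, hcc⟩ := exists_semilinear_involution hτ (AdjoinRoot.root f)
    (by rw [hf, aeval_root_eq_zero]) (Or.inl rfl)
  obtain ⟨e, heθ, hee⟩ := exists_root_inversion hc0 hf'
  obtain ⟨k, hk⟩ := hne
  have hcne : c (algebraMap F _ k) ≠ algebraMap F _ k := by
    rw [hcF]
    exact fun h => hk ((algebraMap F (AdjoinRoot f)).injective h)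
  have h1 := involution_eq_pow hcard c hcc ⟨_, hcne⟩ (algebraMap F _ k)
  have h2 := involution_eq_pow hcard (e : AdjoinRoot f →+* AdjoinRoot f) hee
    ⟨AdjoinRoot.root f, fun h => hθ (h.symm.trans heθ)⟩ (algebraMap F _ k)
  apply hcne
  rw [h1, ← h2]
  exact e.commutes k

/-- The component of a factor that is self-reciprocal but not self-conjugate. -/
theorem hasComponent_selfReciprocal [Finite F] (hirr : Irreducible f) (hm : f.Monic)
    (hdvd : f ∣ X ^ n - 1)
    (hτ : ∀ k, τ (τ k) = k) {σ : AlgebraicClosure F →+* AlgebraicClosure F}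
    (hσ : ∀ k, σ (algebraMap F _ k) = algebraMap F _ (τ k)) (hq : Nat.card F = q ^ 2)
    (hf : recip f = f) (hf' : f.map τ ≠ f) :
    HasComponent n τ (f * f.map τ) (3 * q ^ f.natDegree + 6) := by
  have := Fact.mk hirr
  have := finite_adjoinRoot hirr.ne_zero
  have hc0 := coeff_zero_ne_zero hdvd
  have hm0 : f.map τ ≠ 0 := (Polynomial.map_ne_zero_iff τ.injective).2 hirr.ne_zero
  have hθ := root_pow_eq_one hdvd
  have hθ0 := ne_zero_of_pow_eq_one hθ
  -- If `θ = θ⁻¹` then `f = X ∓ 1`, which is self-conjugate.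
  have hθne : AdjoinRoot.root f ≠ (AdjoinRoot.root f)⁻¹ := by
    intro h
    apply hf'
    rcases eq_X_sub_C_of_root_eq_inv hm hθ0 h with h | h <;> rw [h] <;> simp
  obtain ⟨e, heθ, hee⟩ := exists_root_inversion hc0 hf
  let H := Subgroup.zpowers e
  let L := IntermediateField.fixedField H
  have hord : orderOf e = 2 := by
    apply orderOf_eq_prime
    · ext
      simp [pow_two, hee]
    · rintro rfl
      exact hθne heθ
  have hfd : FiniteDimensional F (AdjoinRoot f) :=
    (AdjoinRoot.powerBasis hirr.ne_zero).finite
  have hfin : Module.finrank L (AdjoinRoot f) = 2 := by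
    rw [IntermediateField.finrank_fixedField_eq_card, Nat.card_zpowers, hord]
  have hL : Nat.card L = q ^ f.natDegree := by
    have := Module.natCard_eq_pow_finrank (K := L) (V := AdjoinRoot f)
    rw [hfin, natCard_adjoinRoot hirr.ne_zero, hq, ← pow_mul, mul_comm, pow_mul] at this
    exact (Nat.pow_left_injective (n := 2) (by norm_num) this).symm
  -- `E` is a plane over the fixed field `L` of the inversion `e`: rotations act by multiplication
  -- by `θ`, the reflection acts by `e`. This gives matrices over `L` rather than over `E`.
  let eL : AdjoinRoot f →ₗ[L] AdjoinRoot f :=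
    { toFun := e
      map_add' := map_add e
      map_smul' := fun l x => by
        have hl : e (l : AdjoinRoot f) = l := l.2 ⟨e, Subgroup.mem_zpowers e⟩
        change e ((l : AdjoinRoot f) * x) = (l : AdjoinRoot f) * e x
        rw [map_mul, hl] }
  have heL : ∀ x, eL x = e x := fun _ => rfl
  let lm : AdjoinRoot f →ₐ[F] Module.End L (AdjoinRoot f) :=
    (Algebra.lmul L (AdjoinRoot f)).restrictScalars F
  have hlm : ∀ x y, lm x y = x * y := fun _ _ => rfl
  have hα : lm (AdjoinRoot.root f) ^ n = 1 := by rw [← map_pow, hθ, map_one]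
  have hβ : eL * eL = 1 := by
    ext x
    exact hee x
  have hαβ : lm (AdjoinRoot.root f) * eL * lm (AdjoinRoot.root f) = eL := by
    ext x
    simp only [Module.End.mul_apply, hlm, heL, map_mul, heθ]
    rw [mul_inv_cancel_left₀ hθ0]
  let ρ := dihedralRep (F := F) hα hβ hαβ
  let M := LinearMap.toMatrixAlgEquiv (Module.finBasisOfFinrankEq L (AdjoinRoot f) hfin)
  rw [← hL]
  -- Independence of the automorphisms `1` and `e` over `E`, tested on the vectors `1` and `θ`.
  have hzero : ∀ a b : AdjoinRoot f, lm a + lm b * eL = 0 → a = 0 ∧ b = 0 := by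
    intro a b h
    have h1 := LinearMap.congr_fun h 1
    have h2 := LinearMap.congr_fun h (AdjoinRoot.root f)
    simp only [LinearMap.add_apply, Module.End.mul_apply, hlm, heL, map_one, mul_one, heθ,
      LinearMap.zero_apply] at h1 h2
    have h3 : b * (AdjoinRoot.root f - (AdjoinRoot.root f)⁻¹) = 0 := by
      linear_combination AdjoinRoot.root f * h1 - h2
    have hb : b = 0 := (mul_eq_zero.1 h3).resolve_right (sub_ne_zero.2 hθne)
    exact ⟨by simpa [hb] using h1, hb⟩
  refine ⟨_, _, _, _, isComponent_prod hτ (M.toRingEquiv.toRingHom.comp ρ.toRingHom) _ ?_ ?_⟩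
  · rw [natDegree_mul hirr.ne_zero hm0, natDegree_map, hL, hq, ← pow_mul, ← pow_mul]
    congr 1; ring
  · rintro _ u v rfl h1 h2 z hz
    have h1' := (map_eq_zero_iff _ M.injective).1 h1
    have h2' := (map_eq_zero_iff _ M.injective).1 h2
    have h1'' := (dihedralRep_polynomial_pair hα hβ hαβ u v).symm.trans h1'
    have h2'' := (dihedralRep_hermAdj_polynomial_pair hα hβ hαβ τ
      (α' := lm (AdjoinRoot.root f)⁻¹)
      (by rw [← map_mul, inv_mul_cancel₀ hθ0, map_one]) u v).symm.trans h2'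
    simp only [aeval_algHom_apply] at h1'' h2''
    obtain ⟨a0, a1⟩ := hzero _ _ h1''
    obtain ⟨b0, b1⟩ := hzero _ _ h2''
    simp only [map_mul, mul_eq_zero] at hz
    rcases hz with hz | hz
    · exact ⟨aeval_eq_zero_of_aeval_root hz a0, aeval_eq_zero_of_aeval_root hz a1⟩
    · rw [aeval_map_eq_zero_iff hτ hσ] at hz
      have hz' := hz
      rw [← hf] at hz'
      have hz0 := ne_zero_of_aeval_recip_eq_zero hc0 hz'
      rw [aeval_recip_eq_zero hc0 hz0] at hz'
      have e1 := aeval_inv_eq_zero_of_aeval_root_inv hz' b0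
      rw [inv_inv] at e1
      exact ⟨aeval_eq_zero_of_map hσ e1,
        aeval_eq_zero_of_map hσ (aeval_eq_zero_of_aeval_root hz b1)⟩

/-- The component of a linear factor `X ∓ 1` in odd characteristic. -/
theorem hasComponent_linear_of_two_ne_zero (hq : q ≠ 0) (hτq : ∀ k, τ k = k ^ q)
    (h2 : (2 : F) ≠ 0) {ε : F} (hεn : ε ^ n = 1) (hε : ε * ε = 1) :
    HasComponent n τ (X - C ε) 1 := by
  -- The two characters sending the rotation to `ε` and the reflection to `1` and `-1`.
  have hα : ((ε, ε) : F × F) ^ n = 1 := by ext <;> simp [hεn]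
  have hβ : ((1, -1) : F × F) * (1, -1) = 1 := by ext <;> simp
  have hαβ : ((ε, ε) : F × F) * (1, -1) * (ε, ε) = (1, -1) := by ext <;> simp [hε]
  have hτε : τ ε * ε = 1 := by
    have h0 : ε ≠ 0 := by rintro rfl; simp at hε
    rcases mul_self_eq_one_iff.1 hε with rfl | rfl <;> simp
  refine ⟨F × F, _, (dihedralRep (F := F) hα hβ hαβ).toRingHom, fun x => (τ x.1, τ x.2),
    fun x => ?_, ?_, ?_, ?_⟩
  · refine dihedralRep_hermAdj hα hβ hαβ τ (τ.prodMap τ).toAddMonoidHom ?_ ?_ ?_ ?_ x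
    · intro x y
      ext <;> simp [mul_comm]
    · intro k; rfl
    · ext <;> simp [hτε]
    · ext <;> simp
  · rw [natDegree_X_sub_C, Nat.card_prod, mul_one, sq]
  · rw [isotropicIdeals_eq_singleton_bot, Set.ncard_singleton]
    intro u hu
    have h1 := congrArg Prod.fst hu
    have h2 := congrArg Prod.snd hu
    simp only [Prod.fst_mul, Prod.snd_mul, hτq, Prod.fst_zero, Prod.snd_zero,
      mul_eq_zero, pow_eq_zero_iff hq, or_self] at h1 h2
    exact Prod.ext h1 h2
  · intro u v h z hz
    have hz' : z = algebraMap F _ ε := by simpa [sub_eq_zero] using hz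
    have h' := (dihedralRep_polynomial_pair hα hβ hαβ u v).symm.trans h
    have hfst : ∀ w : F[X], (aeval ((ε, ε) : F × F) w).1 = w.eval ε := fun w => by
      have := aeval_algHom_apply (AlgHom.fst F F F) (ε, ε) w
      rw [AlgHom.fst_apply, AlgHom.fst_apply, coe_aeval_eq_eval] at this
      exact this.symm
    have hsnd : ∀ w : F[X], (aeval ((ε, ε) : F × F) w).2 = w.eval ε := fun w => by
      have := aeval_algHom_apply (AlgHom.snd F F F) (ε, ε) w
      rw [AlgHom.snd_apply, AlgHom.snd_apply, coe_aeval_eq_eval] at this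
      exact this.symm
    have h3 := congrArg Prod.fst h'
    have h4 := congrArg Prod.snd h'
    simp only [Prod.fst_add, Prod.snd_add, Prod.fst_mul, Prod.snd_mul, hfst, hsnd,
      Prod.fst_zero, Prod.snd_zero] at h3 h4
    have hu : u.eval ε = 0 := by
      have : 2 * u.eval ε = 0 := by linear_combination h3 + h4
      exact (mul_eq_zero.1 this).resolve_left h2
    have hv : v.eval ε = 0 := by linear_combination h3 - hu
    rw [hz', aeval_algebraMap_apply_eq_algebraMap_eval, aeval_algebraMap_apply_eq_algebraMap_eval,
      hu, hv, map_zero]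
    exact ⟨rfl, rfl⟩

/-- The component of the linear factor `X - 1` in characteristic two. -/
theorem hasComponent_linear_of_two_eq_zero (h2 : (2 : F) = 0) :
    HasComponent n τ (X - C 1) 2 := by
  have hα : (1 : DualNumber F) ^ n = 1 := one_pow n
  have htwo : (2 : DualNumber F) = 0 := by
    have := congrArg (algebraMap F (DualNumber F)) h2
    rwa [map_ofNat, map_zero] at this
  have hfst : ∀ k, (algebraMap F (DualNumber F) k).fst = k := fun _ => rfl
  have hsnd : ∀ k, (algebraMap F (DualNumber F) k).snd = 0 := fun _ => rfl
  -- In characteristic two the two characters merge; the reflection becomes the unipotent `1 + ε`,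
  -- an involution since `ε ^ 2 = 0` and `2 = 0`.
  have hβ : (1 + DualNumber.eps : DualNumber F) * (1 + DualNumber.eps) = 1 := by
    linear_combination DualNumber.eps_mul_eps (R := F) + DualNumber.eps * htwo
  have hαβ : (1 : DualNumber F) * (1 + DualNumber.eps) * 1 = 1 + DualNumber.eps := by simp
  let s : DualNumber F →+ DualNumber F := (τ.toAddMonoidHom.prodMap τ.toAddMonoidHom)
  have hs1 : ∀ x, (s x).fst = τ x.fst := fun _ => rfl
  have hs2 : ∀ x, (s x).snd = τ x.snd := fun _ => rfl
  refine ⟨DualNumber F, _, (dihedralRep (F := F) hα hβ hαβ).toRingHom, s,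
    fun x => ?_, ?_, ?_, ?_⟩
  · refine dihedralRep_hermAdj hα hβ hαβ τ s ?_ ?_ ?_ ?_ x
    · intro x y
      ext
      · simp [hs1, mul_comm]
      · simp [hs1, hs2, mul_comm, add_comm]
    · intro k
      ext
      · rw [hs1, hfst, hfst]
      · rw [hs2, hsnd, hsnd, map_zero]
    · ext
      · simp [hs1]
      · simp [hs2]
    · ext
      · simp [hs1]
      · simp [hs2]
  · rw [natDegree_X_sub_C, mul_one, sq]
    exact Nat.card_prod F F
  -- The only ideals are `0`, `(ε)` and the whole ring; the last contains `1`, which is not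
  -- isotropic.
  · have hset : isotropicIdeals s = {⊥, Ideal.span {DualNumber.eps}} := by
      ext I
      simp only [isotropicIdeals, Set.mem_ofPred_eq, Set.mem_insert_iff, Set.mem_singleton_iff]
      constructor
      · intro h
        rcases DualNumber.ideal_trichotomy I with h0 | h0 | rfl
        · exact Or.inl h0
        · exact Or.inr h0
        · exfalso
          have := congrArg TrivSqZeroExt.fst (h 1 Submodule.mem_top 1 Submodule.mem_top)
          simp [hs1] at this
      · rintro (rfl | rfl) u hu v hv
        · rw [(Submodule.mem_bot _).1 hu, zero_mul]
        · obtain ⟨a, rfl⟩ := Ideal.mem_span_singleton'.1 hu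
          obtain ⟨b, rfl⟩ := Ideal.mem_span_singleton'.1 hv
          ext
          · simp [hs1]
          · simp [hs1, hs2]
    rw [hset, Set.ncard_pair]
    intro h
    have h1 : (DualNumber.eps : DualNumber F) ∈ (⊥ : Ideal (DualNumber F)) := by
      rw [h]; exact Ideal.mem_span_singleton_self _
    have := congrArg TrivSqZeroExt.snd ((Submodule.mem_bot _).1 h1)
    simp at this
  · intro u v h z hz
    have hz' : z = algebraMap F _ 1 := by simpa [sub_eq_zero] using hz
    have h' := (dihedralRep_polynomial_pair hα hβ hαβ u v).symm.trans h
    have hev : ∀ w : F[X], aeval (1 : DualNumber F) w = algebraMap F _ (w.eval 1) := fun w => by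
      rw [← aeval_algebraMap_apply_eq_algebraMap_eval, map_one]
    rw [hev, hev] at h'
    have h3 := congrArg TrivSqZeroExt.fst h'
    have h4 := congrArg TrivSqZeroExt.snd h'
    have hv : v.eval 1 = 0 := by simpa [hfst, hsnd] using h4
    have hu : u.eval 1 = 0 := by simpa [hv, hfst] using h3
    rw [hz', aeval_algebraMap_apply_eq_algebraMap_eval, aeval_algebraMap_apply_eq_algebraMap_eval,
      hu, hv, map_zero]
    exact ⟨rfl, rfl⟩

end ComponentsOfFactors

/-! ### Assembling the components -/

section Counting

universe w

variable {F : Type w} [Field F] {n : ℕ}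

/-- `X ^ n - 1` is separable, so `u` would have `n` distinct roots but degree less than `n`. -/
theorem eq_zero_of_forall_root_of_unity (hn : (n : F) ≠ 0) {u : F[X]} (hu : u.degree < n)
    (h : ∀ z : AlgebraicClosure F, z ^ n = 1 → aeval z u = 0) : u = 0 := by
  by_contra h0
  set P : (AlgebraicClosure F)[X] := X ^ n - C 1 with hP
  have hsep : P.Separable := separable_X_pow_sub_C 1
    (by rw [← map_natCast (algebraMap F (AlgebraicClosure F))]; exact (_root_.map_ne_zero _).2 hn)
    one_ne_zero
  have hcard : P.roots.card = n := by
    rw [splits_iff_card_roots.1 (IsAlgClosed.splits P), hP, natDegree_X_pow_sub_C]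
  have hu0 : u.map (algebraMap F (AlgebraicClosure F)) ≠ 0 := Polynomial.map_ne_zero h0
  have hle : P.roots ≤ (u.map (algebraMap F (AlgebraicClosure F))).roots := by
    rw [Multiset.le_iff_subset (nodup_roots hsep)]
    intro z hz
    have hz1 : z ^ n = 1 := by
      have := (mem_roots'.1 hz).2
      simpa [hP, sub_eq_zero] using this
    rw [mem_roots hu0, IsRoot.def, eval_map, ← aeval_def]
    exact h z hz1
  have := (Multiset.card_le_card hle).trans (card_roots' _)
  rw [hcard, natDegree_map] at this
  exact absurd ((natDegree_lt_iff_degree_lt h0).2 hu) (not_lt.2 this)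

variable [NeZero n]

theorem natCard_groupAlgebra [Finite F] :
    Nat.card (MonoidAlgebra F (DihedralGroup n)) = Nat.card F ^ (2 * n) := by
  rw [Nat.card_congr MonoidAlgebra.coeffEquiv, Nat.card_congr Finsupp.equivFunOnFinite,
    Nat.card_fun, DihedralGroup.nat_card]

/-- The product of the component maps is injective: an element `u(r) + v(r)s` in its kernel has `u`
and `v` vanishing at every `n`-th root of unity. Both sides have `|F| ^ (2 * n)` elements because
the degrees of the `g j` add up to `n`, so surjectivity is automatic. -/
theorem ncard_isotropicIdeals_hermAdj [Finite F] {τ : F →+* F} {ι : Type*} [Fintype ι]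
    {g : ι → F[X]} {N : ι → ℕ} (hn : (n : F) ≠ 0) (hg : ∏ j, g j = X ^ n - 1)
    (h : ∀ j, HasComponent n τ (g j) (N j)) :
    (isotropicIdeals (hermAdj τ : MonoidAlgebra F (DihedralGroup n) → _)).ncard = ∏ j, N j := by
  choose B instB φ s hc using h
  have hg0 : ∀ j ∈ Finset.univ, g j ≠ 0 := by
    rw [← Finset.prod_ne_zero_iff, hg]
    exact (monic_X_pow_sub_C (1 : F) (NeZero.ne n)).ne_zero
  have hdeg : ∑ j, (g j).natDegree = n := by
    rw [← natDegree_prod _ _ hg0, hg]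
    exact natDegree_X_pow_sub_C
  have hfin : ∀ j, Finite (B j) := fun j => by
    apply Nat.finite_of_card_ne_zero
    rw [(hc j).card]
    exact pow_ne_zero _ Nat.card_pos.ne'
  have : Finite (MonoidAlgebra F (DihedralGroup n)) := by
    apply Nat.finite_of_card_ne_zero
    rw [natCard_groupAlgebra]
    exact pow_ne_zero _ Nat.card_pos.ne'
  let Φ : MonoidAlgebra F (DihedralGroup n) →+* ∀ j, B j := RingHom.pi φ
  have hinj : Function.Injective Φ := by
    rw [injective_iff_map_eq_zero]
    intro x hx
    obtain ⟨u, v, hu, hv, rfl⟩ := exists_polynomial_pair x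
    have key : ∀ z : AlgebraicClosure F, z ^ n = 1 → aeval z u = 0 ∧ aeval z v = 0 := by
      intro z hz
      have h0 : aeval z (∏ j, g j) = 0 := by rw [hg]; simp [hz]
      rw [map_prod, Finset.prod_eq_zero_iff] at h0
      obtain ⟨j, -, hj⟩ := h0
      exact (hc j).vanish u v (congrFun hx j) z hj
    rw [eq_zero_of_forall_root_of_unity hn hu fun z hz => (key z hz).1,
      eq_zero_of_forall_root_of_unity hn hv fun z hz => (key z hz).2]
    simp
  have hbij : Function.Bijective Φ := by
    rw [Nat.bijective_iff_injective_and_card]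
    refine ⟨hinj, ?_⟩
    rw [natCard_groupAlgebra, Nat.card_pi]
    simp only [(hc _).card]
    rw [Finset.prod_pow_eq_pow_sum, ← Finset.mul_sum, hdeg]
  rw [ncard_isotropicIdeals_congr (RingEquiv.ofBijective Φ hbij)
    (t := fun x j => s j (x j)), ncard_isotropicIdeals_pi]
  · simp only [(hc _).count]
  · intro x
    ext j
    exact (hc j).map_hermAdj x

end Counting

/-! ### Products over the classes of factors -/

section Factors

variable {F : Type*} [Field F] {ι : Type*} {q : ℕ} {f : ι → F[X]}

open Classical in
/-- The function taking the given values on `J0`, `J1`, `J2 ∪ J3` and `J4`. -/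
noncomputable def byClass {M : Type*} (q : ℕ) (f : ι → F[X]) (a b c d : ι → M) (j : ι) : M :=
  if f j = conj q (f j) then if f j = recip (f j) then a j else c j
  else if f j = recip (f j) then b j
  else if conj q (f j) = recip (f j) then c j else d j

open Classical in
theorem prod_classes [Fintype ι] {M : Type*} [CommMonoid M] (a b c d : ι → M) :
    (∏ j ∈ J0 q f, a j) * (∏ j ∈ J1 q f, b j) * (∏ j ∈ J2 q f ∪ J3 q f, c j) *
      (∏ j ∈ J4 q f, d j) = ∏ j, byClass q f a b c d j := by
  have hs : ∀ (s : Finset ι) (e : ι → M), ∏ j ∈ s, e j = ∏ j, if j ∈ s then e j else 1 := by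
    intro s e
    rw [Finset.prod_ite_mem, Finset.univ_inter]
  rw [hs (J0 q f), hs (J1 q f), hs (J2 q f ∪ J3 q f), hs (J4 q f), ← Finset.prod_mul_distrib,
    ← Finset.prod_mul_distrib, ← Finset.prod_mul_distrib]
  refine Finset.prod_congr rfl fun j _ => ?_
  simp only [byClass, J0, J1, J2, J3, J4, Finset.mem_filter, Finset.mem_univ, true_and,
    Finset.mem_union]
  by_cases h1 : f j = conj q (f j)
  · by_cases h2 : f j = recip (f j)
    · simp [← h1, ← h2]
    · simp [← h1, h2]
  · by_cases h2 : f j = recip (f j)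
    · simp [h1, ← h2]
    · by_cases h3 : conj q (f j) = recip (f j)
      · simp [h2, h3]
      · simp [h1, h2, h3]

theorem dvd_byClass (j : ι) : f j ∣ byClass q f f (fun j => f j * conj q (f j))
    (fun j => f j * recip (f j)) (fun j => f j * recip (f j) * conj q (f j) * dagger q (f j)) j := by
  unfold byClass
  split_ifs
  · exact dvd_rfl
  · exact dvd_mul_right _ _
  · exact dvd_mul_right _ _
  · exact dvd_mul_right _ _
  · exact ((dvd_mul_right _ _).mul_right _).mul_right _

end Factors

/-! ### Frobenius on a field with q² elements -/

section FrobeniusFields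

variable {F : Type*} [Field F] [Fintype F] {q p m : ℕ}

theorem charP_of_card_eq (hp : p.Prime) (hF : Fintype.card F = (p ^ m) ^ 2) : CharP F p := by
  obtain ⟨p', hp'⟩ := CharP.exists F
  obtain ⟨k, hp'p, hk⟩ := FiniteField.card F p'
  have h1 : p' ∣ (p ^ m) ^ 2 := by
    rw [← hF, hk]
    exact dvd_pow_self _ k.ne_zero
  rw [← pow_mul] at h1
  rwa [← (Nat.prime_dvd_prime_iff_eq hp'p hp).1 (hp'p.dvd_of_dvd_pow h1)]

/-- `X ^ q - X` has at most `q` roots, fewer than the `q ^ 2` elements of `F`. -/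
theorem exists_pow_ne_self (hF : Fintype.card F = q ^ 2) : ∃ k : F, k ^ q ≠ k := by
  by_contra! h
  have h1 : 1 < Fintype.card F := Fintype.one_lt_card
  have hq : 1 < q := by
    by_contra hq
    interval_cases q <;> omega
  have hne := FiniteField.X_pow_card_sub_X_ne_zero F hq
  have := card_roots' (X ^ q - X : F[X])
  rw [FiniteField.X_pow_card_sub_X_natDegree_eq F hq] at this
  have h2 : Finset.univ.val ≤ (X ^ q - X : F[X]).roots := by
    rw [Multiset.le_iff_subset Finset.univ.nodup]
    intro k _
    rw [mem_roots hne]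
    simp [h k]
  have h3 := (Multiset.card_le_card h2).trans this
  rw [Finset.card_val, Finset.card_univ, hF] at h3
  nlinarith

theorem recip_X_sub_one {F : Type*} [Field F] : recip (X - C (1 : F)) = X - C 1 := by
  rw [recip, reverse, natDegree_X_sub_C, reflect_sub, reflect_one_X, reflect_C]
  simp

end FrobeniusFields

/-! ### The count for a given decomposition -/

section FinalCount

universe w

variable {F : Type w} [Field F] {ι : Type*} [Fintype ι] {q n : ℕ}
  {f : ι → F[X]}

theorem IsDecomposition.prod_byClass (hf : IsDecomposition q n f) :
    ∏ j, byClass q f f (fun j => f j * conj q (f j)) (fun j => f j * recip (f j))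
      (fun j => f j * recip (f j) * conj q (f j) * dagger q (f j)) j = X ^ n - 1 := by
  rw [← prod_classes, hf.prod_eq]

theorem IsDecomposition.dvd (hf : IsDecomposition q n f) (j : ι) : f j ∣ X ^ n - 1 := by
  rw [← hf.prod_byClass]
  exact (dvd_byClass j).trans (Finset.dvd_prod_of_mem _ (Finset.mem_univ j))

variable [Fintype F] [NeZero n] {τ : F →+* F}

/-- The factors in `J0` are `X - 1` and `X + 1`. -/
theorem IsDecomposition.eq_of_conj_eq_of_recip_eq (hf : IsDecomposition q n f)
    (hF : Fintype.card F = q ^ 2) (hτ : ∀ k, τ k = k ^ q) (hττ : ∀ k, τ (τ k) = k) {j : ι}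
    (h1 : f j = conj q (f j)) (h2 : f j = recip (f j)) : f j = X - C 1 ∨ f j = X - C (-1) := by
  have := Fact.mk (hf.irreducible j)
  have hne : ∃ k, τ k ≠ k := by
    simp only [hτ]
    exact exists_pow_ne_self hF
  refine eq_X_sub_C_of_root_eq_inv (hf.monic j)
    (ne_zero_of_pow_eq_one (root_pow_eq_one (hf.dvd j)))
    (root_eq_inv_of_conj_eq_recip_eq (coeff_zero_ne_zero (hf.dvd j)) hττ hne
      (by rw [Nat.card_eq_fintype_card, hF]) ?_ h2.symm)
  rw [← conj_eq_map hτ, ← h1]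

/-- The number of hermitian self-orthogonal codes, up to the factor contributed by `J0`. -/
theorem IsDecomposition.ncard_isotropicIdeals (hf : IsDecomposition q n f) {p m : ℕ}
    [ExpChar F p] (hqp : q = p ^ m) (hF : Fintype.card F = q ^ 2) (hn : (n : F) ≠ 0)
    (hτ : ∀ k, τ k = k ^ q) (hττ : ∀ k, τ (τ k) = k) {N₀ : ℕ}
    (h0 : ∀ j, f j = conj q (f j) → f j = recip (f j) → HasComponent n τ (f j) N₀) :
    (isotropicIdeals (hermAdj τ : MonoidAlgebra F (DihedralGroup n) → _)).ncard =
      N₀ ^ (J0 q f).card * codeCount q f := by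
  classical
  have hF' : Nat.card F = q ^ 2 := by rw [Nat.card_eq_fintype_card, hF]
  have hne : ∃ k, τ k ≠ k := by
    simp only [hτ]
    exact exists_pow_ne_self hF
  have hΩ : ExpChar (AlgebraicClosure F) p := expChar_of_injective_algebraMap
    (algebraMap F (AlgebraicClosure F)).injective p
  -- The same power of Frobenius, taken on the algebraic closure, extends `τ`.
  have hσ : ∀ k, iterateFrobenius (AlgebraicClosure F) p m (algebraMap F _ k) =
      algebraMap F _ (τ k) := by
    intro k
    rw [iterateFrobenius_def, hτ, hqp, map_pow]
  rw [ncard_isotropicIdeals_hermAdj hn hf.prod_byClass (N := byClass q f (fun _ => N₀)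
    (fun j => 3 * q ^ (f j).natDegree + 6) (fun j => q ^ (f j).natDegree + 2)
    (fun j => 3 * q ^ (2 * (f j).natDegree) + 6)), ← prod_classes, Finset.prod_const, codeCount]
  · simp only [mul_assoc]
  · intro j
    have hirr := hf.irreducible j
    have hdvd := hf.dvd j
    unfold byClass
    by_cases h1 : f j = conj q (f j) <;> by_cases h2 : f j = recip (f j)
    · rw [if_pos h1, if_pos h2, if_pos h1, if_pos h2]
      exact h0 j h1 h2
    · rw [if_pos h1, if_neg h2, if_pos h1, if_neg h2]
      refine hasComponent_unitary hirr hdvd hττ hne hF' hqp (Or.inl ?_)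
      rw [← conj_eq_map hτ, ← h1]
    · rw [if_neg h1, if_pos h2, if_neg h1, if_pos h2]
      beta_reduce
      rw [conj_eq_map hτ]
      refine hasComponent_selfReciprocal hirr (hf.monic j) hdvd hττ hσ hF' h2.symm ?_
      rw [← conj_eq_map hτ]
      exact fun h => h1 h.symm
    · rw [if_neg h1, if_neg h2, if_neg h1, if_neg h2]
      by_cases h3 : conj q (f j) = recip (f j)
      · rw [if_pos h3, if_pos h3]
        refine hasComponent_unitary hirr hdvd hττ hne hF' hqp (Or.inr ?_)
        rw [← conj_eq_map hτ, h3]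
      · rw [if_neg h3, if_neg h3]
        beta_reduce
        rw [dagger, conj_eq_map hτ, conj_eq_map hτ, pow_mul, ← hF']
        exact hasComponent_quadruple hirr hdvd hττ hσ

/-- In characteristic two the only factor in `J0` is `X - 1`. -/
theorem IsDecomposition.card_J0 (hf : IsDecomposition q n f) (hF : Fintype.card F = q ^ 2)
    (hn : (n : F) ≠ 0) (hτ : ∀ k, τ k = k ^ q) (hττ : ∀ k, τ (τ k) = k) (h2 : (2 : F) = 0) :
    (J0 q f).card = 1 := by
  classical
  have hneg : (-1 : F) = 1 := by linear_combination -h2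
  have hlin : ∀ j ∈ J0 q f, f j = X - C 1 := by
    intro j hj
    simp only [J0, Finset.mem_filter, Finset.mem_univ, true_and] at hj
    have := hf.eq_of_conj_eq_of_recip_eq hF hτ hττ hj.1 hj.2
    rwa [hneg, or_self] at this
  have hprod := hf.prod_byClass
  set g := byClass q f f (fun j => f j * conj q (f j)) (fun j => f j * recip (f j))
    (fun j => f j * recip (f j) * conj q (f j) * dagger q (f j)) with hg
  rw [Finset.card_eq_one]
  -- Since `1` is a root of the product, it is a root of some `f j`, its reciprocal or its
  -- conjugates; both operations preserve having the root `1`.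
  have hex : ∃ j, (f j).eval 1 = 0 := by
    have h0 : aeval (1 : F) (∏ j, g j) = 0 := by rw [hprod]; simp
    rw [map_prod, Finset.prod_eq_zero_iff] at h0
    obtain ⟨j, -, hj⟩ := h0
    refine ⟨j, ?_⟩
    have hc0 := coeff_zero_ne_zero (hf.dvd j)
    have hr : aeval (1 : F) (recip (f j)) = 0 → (f j).eval 1 = 0 := by
      intro h
      rw [aeval_recip_eq_zero hc0 one_ne_zero, inv_one] at h
      simpa using h
    have hm : ∀ w : F[X], aeval (1 : F) (conj q w) = 0 → aeval (1 : F) w = 0 := by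
      intro w h
      have h' := aeval_map_semilinear (K := F) (c := τ) (fun _ => rfl) 1 w
      rw [map_one, ← conj_eq_map hτ, h] at h'
      exact (map_eq_zero τ).1 h'.symm
    simp only [hg, byClass] at hj
    split_ifs at hj
    · simpa using hj
    all_goals simp only [map_mul, mul_eq_zero, dagger] at hj
    · rcases hj with hj | hj
      · simpa using hj
      · exact hr hj
    · rcases hj with hj | hj
      · simpa using hj
      · simpa using hm _ hj
    · rcases hj with hj | hj
      · simpa using hj
      · exact hr hj
    · rcases hj with ((hj | hj) | hj) | hj
      · simpa using hj
      · exact hr hj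
      · simpa using hm _ hj
      · exact hr (hm _ hj)
  obtain ⟨j, hj⟩ := hex
  have hfj : f j = X - C 1 := (eq_of_monic_of_associated (monic_X_sub_C 1) (hf.monic j)
    ((irreducible_X_sub_C 1).associated_of_dvd (hf.irreducible j) (dvd_iff_isRoot.2 hj))).symm
  refine ⟨j, Finset.eq_singleton_iff_unique_mem.2 ⟨?_, ?_⟩⟩
  · simp only [J0, Finset.mem_filter, Finset.mem_univ, true_and]
    rw [conj_eq_map hτ, hfj, recip_X_sub_one]
    simp
  · intro i hi
    by_contra hij
    have hsq : Squarefree (X ^ n - C 1 : F[X]) :=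
      (separable_X_pow_sub_C 1 hn one_ne_zero).squarefree
    -- A second index in `J0` would make `(X - 1) ^ 2` divide the squarefree polynomial `X ^ n - 1`.
    have hdvd : (X - C 1 : F[X]) * (X - C 1) ∣ X ^ n - C 1 := by
      rw [C_1, ← hprod, ← Finset.mul_prod_erase _ _ (Finset.mem_univ j)]
      refine mul_dvd_mul ?_ ?_
      · rw [← C_1, ← hfj]
        exact dvd_byClass j
      · rw [← C_1, ← hlin i hi]
        exact (dvd_byClass i).trans
          (Finset.dvd_prod_of_mem _ (Finset.mem_erase.2 ⟨hij, Finset.mem_univ i⟩))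
    exact (irreducible_X_sub_C (1 : F)).not_isUnit (hsq _ hdvd)

end FinalCount

end DihedralCodes

/-! ### The count for odd and even q -/

theorem corollary3p9 {F : Type*} [Field F] [Fintype F] {ι : Type*} [Fintype ι]
    (q n : ℕ) [NeZero n] (hq : IsPrimePow q) (hF : Fintype.card F = q ^ 2)
    (hqn : Nat.Coprime q n)
    (f : ι → Polynomial F) (hf : DihedralCodes.IsDecomposition q n f) :
    (Odd q →
      {I : Ideal (MonoidAlgebra F (DihedralGroup n)) |
        DihedralCodes.IsHermSelfOrthogonal q I}.ncard = DihedralCodes.codeCount q f) ∧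
    (Even q →
      {I : Ideal (MonoidAlgebra F (DihedralGroup n)) |
        DihedralCodes.IsHermSelfOrthogonal q I}.ncard = 2 * DihedralCodes.codeCount q f) := by
  open Polynomial DihedralCodes in
  obtain ⟨p, m, hp, hm, rfl⟩ := (isPrimePow_nat_iff q).1 hq
  have hcp : CharP F p := charP_of_card_eq hp hF
  have := Fact.mk hp
  have hexp : ExpChar F p := ExpChar.prime hp
  have hq0 : p ^ m ≠ 0 := hq.ne_zero
  have hn : (n : F) ≠ 0 := by
    rw [Ne, CharP.cast_eq_zero_iff F p]
    intro h
    exact hp.one_lt.ne' (Nat.eq_one_of_dvd_coprimes hqn (dvd_pow_self p hm.ne') h)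
  let τ : F →+* F := iterateFrobenius F p m
  have hτ : ∀ k, τ k = k ^ p ^ m := iterateFrobenius_def p m
  have hττ : ∀ k, τ (τ k) = k := by
    intro k
    rw [hτ, hτ, ← pow_mul, ← sq, ← hF, FiniteField.pow_card]
  have hset : {I : Ideal (MonoidAlgebra F (DihedralGroup n)) | IsHermSelfOrthogonal (p ^ m) I} =
      isotropicIdeals (hermAdj τ) := by
    ext I
    exact isHermSelfOrthogonal_iff hτ hq0 I
  have htwo : (2 : F) = 0 ↔ p = 2 := by
    have := CharP.cast_eq_zero_iff F p 2
    rw [Nat.cast_ofNat, Nat.prime_dvd_prime_iff_eq hp Nat.prime_two] at this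
    exact this
  rw [hset]
  constructor
  · intro hodd
    have h2 : (2 : F) ≠ 0 := by
      rw [Ne, htwo]
      rintro rfl
      exact Nat.not_even_iff_odd.2 hodd (even_two.pow_of_ne_zero hm.ne')
    -- Each factor in `J0` contributes 1, so the size of `J0` is irrelevant.
    rw [hf.ncard_isotropicIdeals rfl hF hn hτ hττ (N₀ := 1), one_pow, one_mul]
    intro j h1 h1'
    have hε : ∀ ε : F, ε * ε = 1 → f j = X - C ε → HasComponent n τ (f j) 1 := by
      intro ε hε hj
      have hεn : ε ^ n = 1 := by
        have := hf.dvd j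
        rw [hj, dvd_iff_isRoot] at this
        simpa [sub_eq_zero] using this
      rw [hj]
      exact hasComponent_linear_of_two_ne_zero hq0 hτ h2 hεn hε
    rcases hf.eq_of_conj_eq_of_recip_eq hF hτ hττ h1 h1' with h | h
    · exact hε 1 (by ring) h
    · exact hε (-1) (by ring) h
  · intro heven
    have h2 : (2 : F) = 0 := by
      rw [htwo]
      exact ((Nat.prime_dvd_prime_iff_eq Nat.prime_two hp).1
        (Nat.prime_two.dvd_of_dvd_pow heven.two_dvd)).symm
    -- Each factor in `J0` contributes 2, and `X - 1` is the only one.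
    rw [hf.ncard_isotropicIdeals rfl hF hn hτ hττ (N₀ := 2), hf.card_J0 hF hn hτ hττ h2, pow_one]
    intro j h1 h1'
    have hneg : (-1 : F) = 1 := by linear_combination -h2
    have hj := hf.eq_of_conj_eq_of_recip_eq hF hτ hττ h1 h1'
    rw [hneg, or_self] at hj
    rw [hj]
    exact hasComponent_linear_of_two_eq_zero h2
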